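/- There is a universal constant $C>0$ such that the following holds. Let $\Sigma$ be a finite set, $n\ge 0$, and let $\mu=\sum_{a=1}^k\rho(a)\mu_a$ be a mixture of distributions $\mu_1,\dots,\mu_k$ on $\Sigma^n$, where $\rho$ is a distribution on $[k]$ with $\rho^*=\min_a\rho(a)>0$. For a distribution $\nu$ on $\Sigma^n$, $x\in\Sigma^n$ and $i\in[n]$, let $\nu|_{x\setminus i}$ denote $\nu$ conditioned on the set of all $y$ with $y_j=x_j$ for every $j\ne i$ (when this set has positive mass), let $\mathrm{Ent}_\nu[f]=\mathbb E_\nu[f\log f]-\mathbb E_\nu[f]\log\mathbb E_\nu[f]$, and let $\mathcal L_\nu[f]=\sum_{i\in[n]}\mathbb E_{x\sim\nu}\,\mathrm{Ent}_{y\sim\nu|_{x\setminus i}}[f(y)]$. Assume that every $\mu_a$ satisfies $c^*$-approximate tensorization of entropy, i.e. $\mathrm{Ent}_{\mu_a}[f]\le c^*\,\mathcal L_{\mu_a}[f]$ for all $f:\Sigma^n\to\mathbb R_{\ge0}$, with a constant $c^*\ge1$; and that $\mu$ is $\eta$-balanced for some $\eta>0$, i.e. every $\mu|_{x\setminus i}$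 is defined and gives probability at least $\eta$ to each of the points that agree with $x$ outside the coordinate $i$. Then for every $\varepsilon>0$ there is a randomized adaptive algorithm (which may depend on $\rho,\mu_1,\dots,\mu_k,c^*,\eta,\varepsilon$) that, given access to an unknown distribution $\pi$ on $\Sigma^n$ through a General Oracle (each call returns a fresh sample from $\pi$) and a Coordinate Oracle (a call with $(x,i)$ returns a fresh sample from $\pi|_{x\setminus i}$, or an arbitrarily distributed answer if the conditioning set has $\pi$-mass $0$), makes in the worst case at most $$C\cdot\frac{c^*n}{\varepsilon}\,\log^2\!\Big(2+\frac{c^*n}{\varepsilon}\Big)\sqrt{|\Sigma|}\,\log(1/\eta)\,\log\big(2+\log(1/\eta)\big)\;+\;C\cdot\frac{\sqrt k\,\log(1/\rho^*)}{\varepsilon}$$ oracle calls in total, and such that 1. if $\pi=\mu$, the algorithm rejects with probability at most $0.4$; 2. if $\mathrm{KL}(\pi\,\|\,\mu)\ge\varepsilon$, the algorithm rejects with probability at least $0.6$. -/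

import Mathlib

open scoped ENNReal

universe u

namespace IdentityTesting

/-! ### Entropy and divergence -/

/-- The entropy `E_w[Φ(f)] - Φ(E_w[f])`, `Φ(u) = u log u` (with `0 log 0 = 0`), of a function `f` on
a finite set with respect to the probability weights `w`. -/
noncomputable def ent {Ω : Type*} [Fintype Ω] (w f : Ω → ℝ) : ℝ :=
  ∑ x, w x * (f x * Real.log (f x)) - (∑ x, w x * f x) * Real.log (∑ x, w x * f x)

/-- Kullback-Leibler divergence of two discrete distributions (`∞` when `π` is not absolutely
continuous with respect to `μ`); every set is measurable. -/
noncomputable def klDiv {Ω : Type*} (π μ : PMF Ω) : ℝ≥0∞ :=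
  letI : MeasurableSpace Ω := ⊤
  InformationTheory.klDiv π.toMeasure μ.toMeasure

/-! ### Distributions on the product set `Σⁿ`, written `Fin n → S` -/

section Product

variable {n : ℕ} {S : Type u}

/-- The combinatorial line of all `y` that agree with `x` outside the coordinate `i`. -/
def line (x : Fin n → S) (i : Fin n) : Set (Fin n → S) :=
  {y | ∀ j, j ≠ i → y j = x j}

variable [Fintype S]

/-- The mass which `μ` gives to the line through `x` in direction `i`. -/
noncomputable def lineMass (μ : PMF (Fin n → S)) (x : Fin n → S) (i : Fin n) : ℝ :=
  ∑ b : S, (μ (Function.update x i b)).toReal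

open Classical in
/-- The probabilities `y ↦ μ|_{x∖i}(y)` of the conditional distribution of `μ` on the line through
`x` in direction `i`. They are all `0` when that line has mass `0`. -/
noncomputable def condLine (μ : PMF (Fin n → S)) (x : Fin n → S) (i : Fin n) :
    (Fin n → S) → ℝ :=
  fun y => if y ∈ line x i then (μ y).toReal / lineMass μ x i else 0

/-- The local entropy `L_μ[f] = ∑ i, E_{x ∼ μ} Ent_{y ∼ μ|_{x∖i}}[f(y)]`. -/
noncomputable def localEnt (μ : PMF (Fin n → S)) (f : (Fin n → S) → ℝ) : ℝ :=
  ∑ i : Fin n, ∑ x : Fin n → S, (μ x).toReal * ent (condLine μ x i) f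

/-- Approximate tensorization of entropy with constant `c`. -/
def IsATE (c : ℝ) (μ : PMF (Fin n → S)) : Prop :=
  ∀ f : (Fin n → S) → ℝ, (∀ x, 0 ≤ f x) →
    ent (fun x => (μ x).toReal) f ≤ c * localEnt μ f

/-- `η`-balancedness: every conditional distribution on a line gives probability at least `η` to
each of the points `x` with coordinate `i` replaced by `b`. For `η > 0` this forces every line to
have positive mass. -/
def IsBalanced (η : ℝ) (μ : PMF (Fin n → S)) : Prop :=
  ∀ (x : Fin n → S) (i : Fin n) (b : S), η ≤ condLine μ x i (Function.update x i b)

/-- `O x i` is the law of the answer to the query `(x, i)` of a Coordinate Oracle for `π`: it is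
`π|_{x∖i}` whenever that conditional distribution exists; on lines of mass `0` the answer may
follow any law. -/
def IsCoordinateOracle (π : PMF (Fin n → S)) (O : (Fin n → S) → Fin n → PMF (Fin n → S)) :
    Prop :=
  ∀ (x : Fin n → S) (i : Fin n), 0 < lineMass π x i →
    ∀ y, (O x i y).toReal = condLine π x i y

end Product

/-! ### Randomized adaptive algorithms with oracle access -/

/-- A randomized adaptive algorithm with output in `R` and access to a General Oracle and a
Coordinate Oracle for an unknown distribution on `Fin n → S`, as a decision tree:
it stops with an output, or draws internal randomness, or calls the General Oracle, or calls the
Coordinate Oracle at a pair `(x, i)`, and continues according to the answer. -/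
inductive OracleAlg (n : ℕ) (S : Type u) (R : Type) : Type (max u 1)
  | done (r : R) : OracleAlg n S R
  | coin {α : Type} (p : PMF α) (next : α → OracleAlg n S R) : OracleAlg n S R
  | general (next : (Fin n → S) → OracleAlg n S R) : OracleAlg n S R
  | coord (x : Fin n → S) (i : Fin n) (next : (Fin n → S) → OracleAlg n S R) : OracleAlg n S R

namespace OracleAlg

variable {n : ℕ} {S : Type u} {R : Type}

/-- The law of the output when each call of the General Oracle is answered by a fresh sample from
`π` and each call `(x, i)` of the Coordinate Oracle by a fresh sample from `O x i`. -/
noncomputable def run (π : PMF (Fin n → S)) (O : (Fin n → S) → Fin n → PMF (Fin n → S)) :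
    OracleAlg n S R → PMF R
  | done r => PMF.pure r
  | coin p next => p.bind fun a => (next a).run π O
  | general next => π.bind fun z => (next z).run π O
  | coord x i next => (O x i).bind fun z => (next z).run π O

/-- The number of oracle calls (to either oracle) in the worst case over all answers and all
internal randomness. -/
noncomputable def calls : OracleAlg n S R → ℕ∞
  | done _ => 0
  | coin _ next => ⨆ a, (next a).calls
  | general next => 1 + ⨆ z, (next z).calls
  | coord _ _ next => 1 + ⨆ z, (next z).calls

end OracleAlg

/-- The two possible outputs of a tester. -/
inductive Verdict : Type
  | accept
  | reject

/-- The probability that the tester `A` rejects. -/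
noncomputable def rejectProb {n : ℕ} {S : Type u} (A : OracleAlg n S Verdict)
    (π : PMF (Fin n → S)) (O : (Fin n → S) → Fin n → PMF (Fin n → S)) : ℝ :=
  (A.run π O Verdict.reject).toReal

end IdentityTesting

/-! Write `f = π/μ`, so that `KL(π‖μ)` is the entropy of `f` under `μ`. Splitting this entropy over
the mixture gives the entropy under `ρ` of the component means of `f`, plus the `ρ`-average of the
entropies of `f` under the components. The former is the divergence from `ρ` of the law of a label
drawn from the posterior of a sample of `π`. The latter is at most `c * localEnt μ f` by
tensorization, because `localEnt` is concave in the measure (`sum_localEnt_le`), and `localEnt μ f`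
is the `π`-average of the divergences on lines (`localEnt_div`). The result is `klSum_mixture_le`:
if `KL(π‖μ) ≥ ε`, then either the labels or the lines contribute at least `ε/2`.

Both alternatives are detected by one identity test for distributions on a finite set: a
chi-square-like pairing of two independent batches, analysed by Chebyshev's inequality. Labels need
one such test (`exists_mixtureTest`). For lines (`exists_linesTest`), the divergence is cut into
dyadic levels. A level twice as high is tried on twice as many random lines, but each test there
costs half as much, so every level costs the same.

A union bound over many line tests would normally cost a logarithm. Here a rejection is instead
rechecked with fourfold accuracy, repeatedly (`stagedTest`). Under the null hypothesis rechecks are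
so rare that the expected cost stays bounded while the error becomes arbitrarily small. Finally a
budget that rejects on overrun turns expected cost into worst-case cost: it can only help detection,
and by Markov's inequality it adds little error under the null. Hence cost is bounded only under the
null. -/

namespace IdentityTesting

/-! ### Composition, expected cost and truncation of oracle algorithms. -/

namespace OracleAlg

variable {n : ℕ} {S : Type u} {R R' : Type}

/-- Sequential composition: run the first algorithm and continue according to its output. -/
def bind : OracleAlg n S R → (R → OracleAlg n S R') → OracleAlg n S R'
  | done r, f => f r
  | coin p next, f => coin p fun a => (next a).bind f
  | general next, f => general fun z => (next z).bind f
  | coord x i next, f => coord x i fun z => (next z).bind f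

/-- The expected number of oracle calls. -/
noncomputable def expCalls (π : PMF (Fin n → S)) (O : (Fin n → S) → Fin n → PMF (Fin n → S)) :
    OracleAlg n S R → ℝ≥0∞
  | done _ => 0
  | coin p next => ∑' a, p a * (next a).expCalls π O
  | general next => 1 + ∑' z, π z * (next z).expCalls π O
  | coord x i next => 1 + ∑' z, O x i z * (next z).expCalls π O

/-- Run the algorithm with a budget of `N` oracle calls, and reject when the budget is exceeded. -/
def truncate : OracleAlg n S Verdict → ℕ → OracleAlg n S Verdict
  | done r, _ => done r
  | coin p next, N => coin p fun a => (next a).truncate N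
  | general next, N => match N with
    | 0 => done Verdict.reject
    | N + 1 => general fun z => (next z).truncate N
  | coord x i next, N => match N with
    | 0 => done Verdict.reject
    | N + 1 => coord x i fun z => (next z).truncate N

variable (π : PMF (Fin n → S)) (O : (Fin n → S) → Fin n → PMF (Fin n → S))

theorem run_bind (A : OracleAlg n S R) (f : R → OracleAlg n S R') :
    (A.bind f).run π O = (A.run π O).bind fun r => (f r).run π O := by
  induction A with
  | done r => simp [bind, run]
  | coin p next ih => simp [bind, run, ih, PMF.bind_bind]
  | general next ih => simp [bind, run, ih, PMF.bind_bind]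
  | coord x i next ih => simp [bind, run, ih, PMF.bind_bind]

theorem tsum_bind_mul {α : Type*} (p : PMF α) (g : α → PMF R) (F : R → ℝ≥0∞) :
    ∑' r, (p.bind g) r * F r = ∑' a, p a * ∑' r, g a r * F r := by
  simp only [PMF.bind_apply, ← ENNReal.tsum_mul_right, ← ENNReal.tsum_mul_left]
  rw [ENNReal.tsum_comm]
  simp only [mul_assoc]

theorem expCalls_bind (A : OracleAlg n S R) (f : R → OracleAlg n S R') :
    (A.bind f).expCalls π O =
      A.expCalls π O + ∑' r, A.run π O r * (f r).expCalls π O := by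
  classical
  induction A with
  | done r =>
    simp only [bind, run, expCalls, PMF.pure_apply, zero_add]
    rw [tsum_eq_single r (by intro b hb; simp [hb])]
    simp
  | coin p next ih =>
    simp only [bind, run, expCalls, ih, tsum_bind_mul, mul_add, ENNReal.tsum_add]
  | general next ih =>
    simp only [bind, run, expCalls, ih, tsum_bind_mul, mul_add, ENNReal.tsum_add, add_assoc]
  | coord x i next ih =>
    simp only [bind, run, expCalls, ih, tsum_bind_mul, mul_add, ENNReal.tsum_add, add_assoc]

theorem calls_truncate (A : OracleAlg n S Verdict) (N : ℕ) : (A.truncate N).calls ≤ N := by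
  induction A generalizing N with
  | done r => simp [truncate, calls]
  | coin p next ih => simpa [truncate, calls] using fun a => ih a N
  | general next ih =>
    cases N with
    | zero => simp [truncate, calls]
    | succ N =>
      simp only [truncate, calls, Nat.cast_add, Nat.cast_one]
      rw [add_comm]
      gcongr
      exact iSup_le fun z => ih z N
  | coord x i next ih =>
    cases N with
    | zero => simp [truncate, calls]
    | succ N =>
      simp only [truncate, calls, Nat.cast_add, Nat.cast_one]
      rw [add_comm]
      gcongr
      exact iSup_le fun z => ih z N

theorem run_reject_le_truncate (A : OracleAlg n S Verdict) (N : ℕ) :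
    A.run π O Verdict.reject ≤ (A.truncate N).run π O Verdict.reject := by
  induction A generalizing N with
  | done r => simp [truncate]
  | coin p next ih =>
    simp only [truncate, run, PMF.bind_apply]
    gcongr with a
    exact ih a N
  | general next ih =>
    cases N with
    | zero => exact (PMF.coe_le_one _ _).trans (by simp [truncate, run])
    | succ N =>
      simp only [truncate, run, PMF.bind_apply]
      gcongr with a
      exact ih a N
  | coord x i next ih =>
    cases N with
    | zero => exact (PMF.coe_le_one _ _).trans (by simp [truncate, run])
    | succ N =>
      simp only [truncate, run, PMF.bind_apply]
      gcongr with a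
      exact ih a N

theorem tsum_mul_affine {α : Type*} (p : PMF α) (f g : α → ℝ≥0∞) (c d : ℝ≥0∞) :
    ∑' a, p a * (c * f a + g a + d) = c * ∑' a, p a * f a + ∑' a, p a * g a + d := by
  simp only [mul_add, ENNReal.tsum_add, ENNReal.tsum_mul_right, p.tsum_coe, one_mul,
    mul_left_comm _ c, ENNReal.tsum_mul_left]

/-- Markov's inequality in a form suited to induction: `U` counts the calls already made and `N`
those left, so each call moves one unit from `N` to `U` and the total is fixed. An overrun occurs
only at `N = 0`, where the summand `U` on the right pays for it. -/
theorem truncate_reject_aux (A : OracleAlg n S Verdict) (N U : ℕ) :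
    ((N + U : ℕ) : ℝ≥0∞) * (A.truncate N).run π O Verdict.reject ≤
      ((N + U : ℕ) : ℝ≥0∞) * A.run π O Verdict.reject + A.expCalls π O + U := by
  induction A generalizing N U with
  | done r => simp [truncate, expCalls]
  | coin p next ih =>
    simp only [truncate, run, expCalls, PMF.bind_apply]
    rw [← tsum_mul_affine, ← ENNReal.tsum_mul_left]
    refine ENNReal.tsum_le_tsum fun a => ?_
    rw [mul_left_comm]
    gcongr
    exact ih a N U
  | general next ih =>
    cases N with
    | zero => simp [truncate, run]
    | succ N =>
      simp only [truncate, run, expCalls, PMF.bind_apply]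
      have h : ∀ x y : ℝ≥0∞, x + (1 + y) + (U : ℝ≥0∞) = x + y + ((U + 1 : ℕ) : ℝ≥0∞) := by
        intro x y; push_cast; ring
      rw [h, ← tsum_mul_affine, ← ENNReal.tsum_mul_left]
      refine ENNReal.tsum_le_tsum fun a => ?_
      rw [mul_left_comm]
      gcongr
      have := ih a N (U + 1)
      rwa [show N + (U + 1) = N + 1 + U by ring] at this
  | coord x i next ih =>
    cases N with
    | zero => simp [truncate, run]
    | succ N =>
      simp only [truncate, run, expCalls, PMF.bind_apply]
      have h : ∀ x y : ℝ≥0∞, x + (1 + y) + (U : ℝ≥0∞) = x + y + ((U + 1 : ℕ) : ℝ≥0∞) := by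
        intro x y; push_cast; ring
      rw [h, ← tsum_mul_affine, ← ENNReal.tsum_mul_left]
      refine ENNReal.tsum_le_tsum fun a => ?_
      rw [mul_left_comm]
      gcongr
      have := ih a N (U + 1)
      rwa [show N + (U + 1) = N + 1 + U by ring] at this

end OracleAlg

open OracleAlg

/-! ### Rejection probabilities under composition and truncation. -/

section Reject

variable {n : ℕ} {S : Type u} (π : PMF (Fin n → S))
  (O : (Fin n → S) → Fin n → PMF (Fin n → S))

theorem rejectProb_nonneg (A : OracleAlg n S Verdict) : 0 ≤ rejectProb A π O :=
  ENNReal.toReal_nonneg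

theorem rejectProb_le_one (A : OracleAlg n S Verdict) : rejectProb A π O ≤ 1 :=
  ENNReal.toReal_le_of_le_ofReal zero_le_one (by simpa using PMF.coe_le_one _ _)

theorem tsum_verdict (F : Verdict → ℝ≥0∞) :
    ∑' v, F v = F Verdict.accept + F Verdict.reject := by
  classical
  rw [tsum_eq_sum (s := {Verdict.accept, Verdict.reject}) (by intro v hv; cases v <;> simp at hv),
    Finset.sum_pair (by simp)]

theorem run_accept_toReal (A : OracleAlg n S Verdict) :
    (A.run π O Verdict.accept).toReal = 1 - rejectProb A π O := by
  have h := (A.run π O).tsum_coe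
  rw [tsum_verdict] at h
  have h2 := congrArg ENNReal.toReal h
  rw [ENNReal.toReal_add (PMF.apply_ne_top _ _) (PMF.apply_ne_top _ _), ENNReal.toReal_one] at h2
  rw [rejectProb]; linarith

/-- Run `B` after `A` accepts; reject if `A` rejects. -/
def onAccept (A B : OracleAlg n S Verdict) : OracleAlg n S Verdict :=
  A.bind fun
    | Verdict.accept => B
    | Verdict.reject => done Verdict.reject

/-- Run `B` after `A` rejects; accept if `A` accepts. -/
def onReject (A B : OracleAlg n S Verdict) : OracleAlg n S Verdict :=
  A.bind fun
    | Verdict.accept => done Verdict.accept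
    | Verdict.reject => B

theorem rejectProb_onReject (A B : OracleAlg n S Verdict) :
    rejectProb (onReject A B) π O = rejectProb A π O * rejectProb B π O := by
  simp [rejectProb, onReject, run_bind, PMF.bind_apply, tsum_verdict, run, PMF.pure_apply]

theorem rejectProb_onAccept (A B : OracleAlg n S Verdict) :
    1 - rejectProb (onAccept A B) π O = (1 - rejectProb A π O) * (1 - rejectProb B π O) := by
  simp only [← run_accept_toReal]
  simp [onAccept, run_bind, PMF.bind_apply, tsum_verdict, run, PMF.pure_apply]

theorem expCalls_onReject (A B : OracleAlg n S Verdict) :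
    (onReject A B).expCalls π O =
      A.expCalls π O + A.run π O Verdict.reject * B.expCalls π O := by
  simp [onReject, expCalls_bind, tsum_verdict, expCalls]

theorem expCalls_onAccept_le (A B : OracleAlg n S Verdict) :
    (onAccept A B).expCalls π O ≤ A.expCalls π O + B.expCalls π O := by
  simp only [onAccept, expCalls_bind, tsum_verdict, expCalls, mul_zero, add_zero]
  gcongr
  exact mul_le_of_le_one_left zero_le (PMF.coe_le_one _ _)

theorem rejectProb_le_truncate (A : OracleAlg n S Verdict) (N : ℕ) :
    rejectProb A π O ≤ rejectProb (A.truncate N) π O :=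
  ENNReal.toReal_mono (PMF.apply_ne_top _ _) (run_reject_le_truncate π O A N)

theorem rejectProb_truncate_le (A : OracleAlg n S Verdict) {N : ℕ} (hN : 0 < N) {V : ℝ}
    (hV : 0 ≤ V) (hA : A.expCalls π O ≤ ENNReal.ofReal V) :
    rejectProb (A.truncate N) π O ≤ rejectProb A π O + V / N := by
  have h := truncate_reject_aux π O A N 0
  have h2 : (N : ℝ≥0∞) * (A.truncate N).run π O Verdict.reject ≤
      N * A.run π O Verdict.reject + ENNReal.ofReal V := by
    refine le_trans (by simpa using h) ?_
    gcongr
  have hfin : (N : ℝ≥0∞) * A.run π O Verdict.reject ≠ ⊤ :=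
    ENNReal.mul_ne_top (by simp) (PMF.apply_ne_top _ _)
  have h3 := ENNReal.toReal_mono (ENNReal.add_ne_top.2 ⟨hfin, ENNReal.ofReal_ne_top⟩) h2
  rw [ENNReal.toReal_add hfin ENNReal.ofReal_ne_top, ENNReal.toReal_mul, ENNReal.toReal_mul,
    ENNReal.toReal_ofReal hV] at h3
  simp only [ENNReal.toReal_natCast] at h3
  have hN' : (0 : ℝ) < N := by exact_mod_cast hN
  have : rejectProb (A.truncate N) π O * N ≤ (rejectProb A π O + V / N) * N := by
    rw [add_mul, div_mul_cancel₀ _ hN'.ne']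
    simp only [rejectProb]
    linarith
  exact le_of_mul_le_mul_right this hN'

end Reject

/-! ### Samplers -/

section Sampler

variable {n : ℕ} {S : Type u} {β : Type*} [Fintype β]

/-- The procedure `smp`, which passes a random element of `β` to its continuation, makes one oracle
call and produces `b` with probability `p b`. -/
structure IsSampler (π : PMF (Fin n → S)) (O : (Fin n → S) → Fin n → PMF (Fin n → S))
    (p : β → ℝ) (smp : (β → OracleAlg n S Verdict) → OracleAlg n S Verdict) : Prop where
  nonneg : ∀ b, 0 ≤ p b
  sum_eq_one : ∑ b, p b = 1
  reject : ∀ f, rejectProb (smp f) π O = ∑ b, p b * rejectProb (f b) π O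
  cost : ∀ f c, (∀ b, (f b).expCalls π O ≤ c) → (smp f).expCalls π O ≤ 1 + c

/-- Draw `m` samples and pass the list of them to the continuation. -/
def drawList (smp : (β → OracleAlg n S Verdict) → OracleAlg n S Verdict) :
    ℕ → (List β → OracleAlg n S Verdict) → OracleAlg n S Verdict
  | 0, f => f []
  | m + 1, f => smp fun b => drawList smp m fun l => f (b :: l)

/-- The expectation of `F` over the list of `m` independent samples of law `p`. -/
def iidExp (p : β → ℝ) : ℕ → (List β → ℝ) → ℝ
  | 0, F => F []
  | m + 1, F => ∑ b, p b * iidExp p m fun l => F (b :: l)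

variable {π : PMF (Fin n → S)} {O : (Fin n → S) → Fin n → PMF (Fin n → S)}
  {p : β → ℝ} {smp : (β → OracleAlg n S Verdict) → OracleAlg n S Verdict}

theorem IsSampler.rejectProb_drawList (h : IsSampler π O p smp) (m : ℕ)
    (f : List β → OracleAlg n S Verdict) :
    rejectProb (drawList smp m f) π O = iidExp p m fun l => rejectProb (f l) π O := by
  induction m generalizing f with
  | zero => rfl
  | succ m ih => simp only [drawList, iidExp, h.reject, ih]

theorem IsSampler.expCalls_drawList (h : IsSampler π O p smp) (m : ℕ)
    (f : List β → OracleAlg n S Verdict) (c : ℝ≥0∞) (hf : ∀ l, (f l).expCalls π O ≤ c) :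
    (drawList smp m f).expCalls π O ≤ m + c := by
  induction m generalizing f with
  | zero => simpa [drawList] using hf []
  | succ m ih =>
    refine (h.cost _ (m + c) fun b => ih _ fun l => hf _).trans ?_
    push_cast
    rw [← add_assoc, add_comm (1 : ℝ≥0∞)]

end Sampler

/-! ### Moments of independent samples. -/

section IidExp

variable {β : Type*} [Fintype β] {p : β → ℝ}

theorem iidExp_mono (hp : ∀ b, 0 ≤ p b) (m : ℕ) {F G : List β → ℝ} (h : ∀ l, F l ≤ G l) :
    iidExp p m F ≤ iidExp p m G := by
  induction m generalizing F G with
  | zero => exact h _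
  | succ m ih =>
    exact Finset.sum_le_sum fun b _ => mul_le_mul_of_nonneg_left (ih fun l => h _) (hp b)

theorem iidExp_add (m : ℕ) (F G : List β → ℝ) :
    iidExp p m (fun l => F l + G l) = iidExp p m F + iidExp p m G := by
  induction m generalizing F G with
  | zero => rfl
  | succ m ih => simp only [iidExp, ih, mul_add, Finset.sum_add_distrib]

theorem iidExp_mul_left (m : ℕ) (c : ℝ) (F : List β → ℝ) :
    iidExp p m (fun l => c * F l) = c * iidExp p m F := by
  induction m generalizing F with
  | zero => rfl
  | succ m ih => simp only [iidExp, ih, Finset.mul_sum, mul_left_comm]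

theorem iidExp_const (hp : ∑ b, p b = 1) (m : ℕ) (c : ℝ) : iidExp p m (fun _ => c) = c := by
  induction m with
  | zero => rfl
  | succ m ih => simp only [iidExp, ih, ← Finset.sum_mul, hp, one_mul]

theorem iidExp_sum {ι : Type*} (s : Finset ι) (m : ℕ) (F : ι → List β → ℝ) :
    iidExp p m (fun l => ∑ i ∈ s, F i l) = ∑ i ∈ s, iidExp p m (F i) := by
  classical
  induction s using Finset.induction_on with
  | empty =>
    have := iidExp_mul_left (p := p) m 0 fun _ => 0
    simpa using this
  | insert a s ha ih => simp only [Finset.sum_insert ha, iidExp_add, ih]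

/-- Variance plus squared bias. Keeping `a` general lets the induction absorb the first sample into
it. -/
theorem iidExp_sum_sub_sq (hp : ∑ b, p b = 1) (f : β → ℝ) (m : ℕ) (a : ℝ) :
    iidExp p m (fun l => ((l.map f).sum - a) ^ 2) =
      m * (∑ b, p b * f b ^ 2 - (∑ b, p b * f b) ^ 2) + (m * ∑ b, p b * f b - a) ^ 2 := by
  induction m generalizing a with
  | zero => simp [iidExp]
  | succ m ih =>
    have h : ∀ b (l : List β), (((b :: l).map f).sum - a) ^ 2 =
        ((l.map f).sum - (a - f b)) ^ 2 := by intro b l; simp; ring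
    simp only [iidExp, h, ih]
    set e := ∑ b, p b * f b
    set v := ∑ b, p b * f b ^ 2
    have h2 : ∀ b, p b * (m * (v - e ^ 2) + (m * e - (a - f b)) ^ 2) =
        p b * (m * (v - e ^ 2) + (m * e - a) ^ 2) + 2 * (m * e - a) * (p b * f b) +
          p b * f b ^ 2 := by intro b; ring
    simp only [h2, Finset.sum_add_distrib, ← Finset.sum_mul, ← Finset.mul_sum, hp]
    push_cast
    ring

theorem variance_sub_const_le {p : β → ℝ} (hp : ∑ b, p b = 1) (h : β → ℝ) (c : ℝ) :
    ∑ b, p b * (h b - c) ^ 2 - (∑ b, p b * (h b - c)) ^ 2 ≤ ∑ b, p b * h b ^ 2 := by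
  have h1 : ∑ b, p b * (h b - c) = ∑ b, p b * h b - c := by
    simp [mul_sub, Finset.sum_sub_distrib, ← Finset.sum_mul, hp]
  have h2 : ∑ b, p b * (h b - c) ^ 2 =
      ∑ b, p b * h b ^ 2 - 2 * c * ∑ b, p b * h b + c ^ 2 := by
    have : ∀ b, p b * (h b - c) ^ 2 = p b * h b ^ 2 - 2 * c * (p b * h b) + p b * c ^ 2 := by
      intro b; ring
    simp only [this, Finset.sum_add_distrib, Finset.sum_sub_distrib, ← Finset.mul_sum,
      ← Finset.sum_mul, hp, one_mul]
  rw [h1, h2]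
  nlinarith [sq_nonneg (∑ b, p b * h b)]

end IidExp

/-! ### The two-batch statistic and its mean squared deviation. -/

section Statistic

variable {β : Type*} [Fintype β] [DecidableEq β]

/-- The centered number of occurrences of `z` in a list of samples. -/
def centeredCount (q : β → ℝ) (Y : List β) (z : β) : ℝ :=
  (Y.map fun y => (if y = z then 1 else 0) - q z).sum

/-- The inner product with weights `w` of the centered indicator of `x` and the centered counts
of `Y`. -/
def countPairing (q w : β → ℝ) (Y : List β) (x : β) : ℝ :=
  w x * centeredCount q Y x - ∑ z, w z * q z * centeredCount q Y z

/-- The inner product with weights `w` of the centered counts of two lists. -/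
def pairingStat (q w : β → ℝ) (Y X : List β) : ℝ :=
  (X.map (countPairing q w Y)).sum

theorem sum_mul_centeredCount (q c : β → ℝ) (Y : List β) :
    ∑ z, c z * centeredCount q Y z = (Y.map fun y => c y - ∑ z, c z * q z).sum := by
  induction Y with
  | nil => simp [centeredCount]
  | cons y Y ih =>
    simp only [centeredCount, List.map_cons, List.sum_cons, mul_add,
      Finset.sum_add_distrib] at ih ⊢
    rw [ih]
    simp [mul_sub, Finset.sum_sub_distrib]

theorem iidExp_centeredCount_sq_le {p : β → ℝ} (hp : ∑ b, p b = 1)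
    (q : β → ℝ) (m : ℕ) (z : β) :
    iidExp p m (fun Y => centeredCount q Y z ^ 2) ≤ m * p z + (m * (p z - q z)) ^ 2 := by
  have h := iidExp_sum_sub_sq hp (fun y => (if y = z then (1 : ℝ) else 0) - q z) m 0
  simp only [sub_zero] at h
  have h1 : ∑ b, p b * ((if b = z then (1 : ℝ) else 0) - q z) = p z - q z := by
    simp [mul_sub, Finset.sum_sub_distrib, ← Finset.sum_mul, hp]
  have h2 : ∑ b, p b * ((if b = z then (1 : ℝ) else 0) - q z) ^ 2 =
      p z - 2 * q z * p z + q z ^ 2 := by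
    have : ∀ b, p b * ((if b = z then (1 : ℝ) else 0) - q z) ^ 2 =
        (if b = z then p b * (1 - 2 * q z) else 0) + p b * q z ^ 2 := by
      intro b; split_ifs <;> ring
    simp only [this, Finset.sum_add_distrib, ← Finset.sum_mul, hp]
    simp
    ring
  simp only [centeredCount]
  rw [h, h1, h2]
  have : (m : ℝ) * (p z - 2 * q z * p z + q z ^ 2 - (p z - q z) ^ 2) ≤ m * p z := by
    gcongr
    nlinarith [sq_nonneg (p z)]
  linarith

/-- With `Y` fixed the statistic is a sum of independent terms in `X`, so its deviation splits into
a variance over `X` and the deviation of its conditional mean, itself a sum of independent terms in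
`Y`. Independence of the batches makes the mean exactly `m ^ 2` times the weighted squared distance,
with no diagonal terms. Each of the two parts contributes one copy of the `m ^ 3` term. -/
theorem iidExp_pairingStat_le {p : β → ℝ} (hp0 : ∀ b, 0 ≤ p b) (hp : ∑ b, p b = 1)
    (q w : β → ℝ) (m : ℕ) :
    iidExp p m (fun Y => iidExp p m fun X =>
        (pairingStat q w Y X - m ^ 2 * ∑ b, w b * (p b - q b) ^ 2) ^ 2) ≤
      m ^ 2 * ∑ b, p b ^ 2 * w b ^ 2 + 2 * m ^ 3 * ∑ b, p b * (w b ^ 2 * (p b - q b) ^ 2) := by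
  set D := ∑ b, w b * (p b - q b) ^ 2 with hD
  set κ := ∑ z, w z * (p z - q z) * q z with hκ
  have hinner : ∀ Y, iidExp p m (fun X => (pairingStat q w Y X - m ^ 2 * D) ^ 2) ≤
      m * (∑ x, p x * w x ^ 2 * centeredCount q Y x ^ 2) +
        m ^ 2 * ((Y.map fun y => w y * (p y - q y) - κ).sum - m * D) ^ 2 := by
    intro Y
    simp only [pairingStat]
    rw [iidExp_sum_sub_sq hp]
    have h1 := variance_sub_const_le hp (fun x => w x * centeredCount q Y x)
      (∑ z, w z * q z * centeredCount q Y z)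
    have h2 : ∑ b, p b * countPairing q w Y b =
        (Y.map fun y => w y * (p y - q y) - κ).sum := by
      rw [hκ, ← sum_mul_centeredCount]
      simp only [countPairing, mul_sub, Finset.sum_sub_distrib, ← Finset.sum_mul, hp, one_mul]
      rw [← Finset.sum_sub_distrib]
      exact Finset.sum_congr rfl fun b _ => by ring
    have h3 : ∑ b, p b * countPairing q w Y b ^ 2 - (∑ b, p b * countPairing q w Y b) ^ 2 ≤
        ∑ x, p x * w x ^ 2 * centeredCount q Y x ^ 2 := by
      refine le_trans h1 (le_of_eq (Finset.sum_congr rfl fun b _ => by ring))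
    rw [h2] at h3 ⊢
    have h4 : (m * (Y.map fun y => w y * (p y - q y) - κ).sum - m ^ 2 * D) ^ 2 =
        m ^ 2 * ((Y.map fun y => w y * (p y - q y) - κ).sum - m * D) ^ 2 := by ring
    rw [h4]
    gcongr
  refine (iidExp_mono hp0 m hinner).trans ?_
  rw [iidExp_add, iidExp_mul_left, iidExp_mul_left, iidExp_sum, iidExp_sum_sub_sq hp]
  have hmean : ∑ b, p b * (w b * (p b - q b) - κ) = D := by
    simp only [mul_sub, Finset.sum_sub_distrib, ← Finset.sum_mul, hp, one_mul]
    rw [hκ, hD, ← Finset.sum_sub_distrib, ← Finset.sum_sub_distrib]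
    exact Finset.sum_congr rfl fun b _ => by ring
  have hvar := variance_sub_const_le hp (fun b => w b * (p b - q b)) κ
  have hcount : ∀ x, iidExp p m (fun Y => p x * w x ^ 2 * centeredCount q Y x ^ 2) ≤
      m * (p x ^ 2 * w x ^ 2) + m ^ 2 * (p x * (w x ^ 2 * (p x - q x) ^ 2)) := by
    intro x
    rw [iidExp_mul_left]
    refine (mul_le_mul_of_nonneg_left (iidExp_centeredCount_sq_le hp q m x)
      (mul_nonneg (hp0 x) (sq_nonneg _))).trans (le_of_eq (by ring))
  have hcount' := Finset.sum_le_sum fun x (_ : x ∈ Finset.univ) => hcount x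
  rw [Finset.sum_add_distrib, ← Finset.mul_sum, ← Finset.mul_sum] at hcount'
  rw [hmean] at hvar ⊢
  have e : ∑ b, p b * (w b * (p b - q b)) ^ 2 = ∑ b, p b * (w b ^ 2 * (p b - q b) ^ 2) :=
    Finset.sum_congr rfl fun b _ => by ring
  rw [e] at hvar
  have h1 := mul_le_mul_of_nonneg_left hcount' (Nat.cast_nonneg (α := ℝ) m)
  have h2 := mul_le_mul_of_nonneg_left hvar (by positivity : (0 : ℝ) ≤ m ^ 2 * m)
  linarith

end Statistic

/-! ### The identity test and its two error bounds. -/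

section Test

variable {n : ℕ} {S : Type u} {β : Type*} [Fintype β]

/-- The weights of the test statistic. -/
noncomputable def testWeight (q : β → ℝ) (θ : ℝ) (b : β) : ℝ :=
  -- The shift caps the weight at `Fintype.card β / θ`, while summing to only `θ` over all points.
  (q b + θ / Fintype.card β)⁻¹

open Classical in
/-- The identity test against `q` with two batches of `m` samples. -/
noncomputable def identityTest (q : β → ℝ) (θ : ℝ) (m : ℕ)
    (smp : (β → OracleAlg n S Verdict) → OracleAlg n S Verdict) : OracleAlg n S Verdict :=
  drawList smp m fun Y => drawList smp m fun X =>
    -- The mean is `0` under the null and at least `m ^ 2 * θ / 2` under the alternatives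
    -- considered; the threshold is halfway.
    done (if m ^ 2 * θ / 4 ≤ pairingStat q (testWeight q θ) Y X then
      Verdict.reject else Verdict.accept)

variable {π : PMF (Fin n → S)} {O : (Fin n → S) → Fin n → PMF (Fin n → S)}
  {p q : β → ℝ} {θ K : ℝ} {m : ℕ}
  {smp : (β → OracleAlg n S Verdict) → OracleAlg n S Verdict}

theorem rejectProb_done_ite (P : Prop) [Decidable P] :
    rejectProb (done (if P then Verdict.reject else Verdict.accept)) π O =
      if P then 1 else 0 := by
  split_ifs <;> simp [rejectProb, run, PMF.pure_apply]

theorem IsSampler.expCalls_identityTest_le (h : IsSampler π O p smp) :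
    (identityTest q θ m smp).expCalls π O ≤ 2 * m := by
  classical
  refine (h.expCalls_drawList m _ m fun Y => ?_).trans_eq (two_mul _).symm
  exact (h.expCalls_drawList m _ 0 fun X => by simp [expCalls]).trans_eq (add_zero _)

theorem testWeight_nonneg (hq : ∀ b, 0 ≤ q b) (hθ : 0 < θ) (b : β) : 0 ≤ testWeight q θ b :=
  inv_nonneg.2 (add_nonneg (hq b) (by positivity))

theorem testWeight_mul_le_one (hq : ∀ b, 0 ≤ q b) (hθ : 0 < θ) (b : β) :
    testWeight q θ b * q b ≤ 1 := by
  have : Nonempty β := ⟨b⟩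
  have h : 0 < θ / Fintype.card β := by positivity
  rw [testWeight, inv_mul_le_iff₀ (by linarith [hq b])]
  linarith

theorem testWeight_le (hq : ∀ b, 0 ≤ q b) (hθ : 0 < θ) (b : β) :
    testWeight q θ b ≤ Fintype.card β / θ := by
  have : Nonempty β := ⟨b⟩
  have h : 0 < θ / Fintype.card β := by positivity
  rw [testWeight, ← inv_div θ]
  exact inv_anti₀ h (le_add_of_nonneg_left (hq b))

theorem sum_sq_mul_testWeight_sq_le (hq : ∀ b, 0 ≤ q b) (hθ : 0 < θ) :
    ∑ b, q b ^ 2 * testWeight q θ b ^ 2 ≤ Fintype.card β := by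
  refine (Finset.sum_le_sum (g := fun _ => (1 : ℝ)) fun b _ => ?_).trans_eq (by simp)
  rw [← mul_pow, mul_comm]
  exact pow_le_one₀ (mul_nonneg (testWeight_nonneg hq hθ b) (hq b)) (testWeight_mul_le_one hq hθ b)

theorem IsSampler.rejectProb_identityTest_null (h : IsSampler π O q smp) (hθ : 0 < θ)
    (hm : 0 < m) (hK : 0 < K) (hmK : K * √(Fintype.card β) ≤ m * θ) :
    rejectProb (identityTest q θ m smp) π O ≤ 16 / K ^ 2 := by
  classical
  have hm' : (0 : ℝ) < m := by exact_mod_cast hm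
  have hdev := iidExp_pairingStat_le h.nonneg h.sum_eq_one q (testWeight q θ) m
  simp only [sub_self, ne_eq, OfNat.ofNat_ne_zero, not_false_eq_true, zero_pow, mul_zero,
    Finset.sum_const_zero, sub_zero, add_zero] at hdev
  have hle : rejectProb (identityTest q θ m smp) π O ≤
      iidExp q m fun Y => iidExp q m fun X =>
        16 / (m ^ 4 * θ ^ 2) * pairingStat q (testWeight q θ) Y X ^ 2 := by
    simp only [identityTest, h.rejectProb_drawList, rejectProb_done_ite]
    refine iidExp_mono h.nonneg m fun Y => iidExp_mono h.nonneg m fun X => ?_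
    split_ifs with hT
    · rw [div_mul_eq_mul_div, le_div_iff₀ (by positivity)]
      have := pow_le_pow_left₀ (by positivity) hT 2
      linarith
    · positivity
  simp only [iidExp_mul_left] at hle
  have hS := sum_sq_mul_testWeight_sq_le h.nonneg hθ
  have hsq := pow_le_pow_left₀ (by positivity) hmK 2
  rw [mul_pow, Real.sq_sqrt (Nat.cast_nonneg _)] at hsq
  calc _ ≤ 16 / (m ^ 4 * θ ^ 2) * (m ^ 2 * Fintype.card β) := by
        refine hle.trans (mul_le_mul_of_nonneg_left (hdev.trans ?_) (by positivity))
        gcongr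
    _ ≤ 16 / K ^ 2 := by
        rw [div_mul_eq_mul_div, div_le_div_iff₀ (by positivity) (by positivity)]
        have : (0 : ℝ) ≤ 16 * m ^ 2 := by positivity
        nlinarith [mul_le_mul_of_nonneg_left hsq this]

/-- Replace `p` by `q` plus the difference: `w * q ≤ 1` handles the first part, and the cap `w ≤ s /
θ` bounds the second by `D`. The constant is `20 = 12 + 2 * 4`, from `hA2` and `hB2`. -/
theorem deviation_bound [Nonempty β] (hq : ∀ b, 0 ≤ q b) (hθ : 0 < θ)
    (hm : 0 < m) (hK : 1 ≤ K) (hmK : K * √(Fintype.card β) ≤ m * θ)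
    (hD : θ / 2 ≤ ∑ b, testWeight q θ b * (p b - q b) ^ 2) :
    m ^ 2 * ∑ b, p b ^ 2 * testWeight q θ b ^ 2 +
        2 * m ^ 3 * ∑ b, p b * (testWeight q θ b ^ 2 * (p b - q b) ^ 2) ≤
      20 / K * (m ^ 4 * (∑ b, testWeight q θ b * (p b - q b) ^ 2) ^ 2) := by
  set w := testWeight q θ
  set D := ∑ b, w b * (p b - q b) ^ 2 with hDdef
  set s : ℝ := (Fintype.card β : ℝ)
  have hs : 1 ≤ s := Nat.one_le_cast.2 Fintype.card_pos
  have hm' : (0 : ℝ) < m := by exact_mod_cast hm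
  have hw0 := testWeight_nonneg hq hθ
  have hwq := testWeight_mul_le_one hq hθ
  have hws := testWeight_le hq hθ
  have hDpos : 0 < D := by linarith
  have hterm : ∀ b, 0 ≤ w b * (p b - q b) ^ 2 := fun b => mul_nonneg (hw0 b) (sq_nonneg _)
  have hsq := pow_le_pow_left₀ (by positivity) hmK 2
  rw [mul_pow, Real.sq_sqrt (by positivity)] at hsq
  have hA : ∑ b, p b ^ 2 * w b ^ 2 ≤ 2 * s + 2 * (s / θ) * D := by
    rw [hDdef, Finset.mul_sum]
    have h2 : 2 * s = ∑ _b : β, (2 : ℝ) := by simp [s, mul_comm]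
    rw [h2, ← Finset.sum_add_distrib]
    refine Finset.sum_le_sum fun b _ => ?_
    have h3 : (w b * q b) ^ 2 ≤ 1 := pow_le_one₀ (mul_nonneg (hw0 b) (hq b)) (hwq b)
    have h4 : w b * (w b * (p b - q b) ^ 2) ≤ s / θ * (w b * (p b - q b) ^ 2) :=
      mul_le_mul_of_nonneg_right (hws b) (hterm b)
    -- The hint is `p² ≤ 2q² + 2(p - q)²` times `w²`.
    nlinarith [mul_nonneg (sq_nonneg (w b)) (sq_nonneg (p b - 2 * q b))]
  have hB : ∑ b, p b * (w b ^ 2 * (p b - q b) ^ 2) ≤ D + √(s * D / θ) * D := by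
    rw [← one_add_mul, hDdef, Finset.mul_sum]
    refine Finset.sum_le_sum fun b _ => ?_
    have h1 : w b * |p b - q b| ≤ √(s * D / θ) := by
      refine Real.le_sqrt_of_sq_le ?_
      have h2 : w b * (p b - q b) ^ 2 ≤ D :=
        Finset.single_le_sum (fun b _ => hterm b) (Finset.mem_univ b)
      calc (w b * |p b - q b|) ^ 2 = w b * (w b * (p b - q b) ^ 2) := by
            rw [mul_pow, sq_abs]; ring
        _ ≤ s / θ * D := mul_le_mul (hws b) h2 (hterm b) (by positivity)
        _ = s * D / θ := by ring
    have h3 : p b ≤ q b + |p b - q b| := by linarith [le_abs_self (p b - q b)]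
    calc p b * (w b ^ 2 * (p b - q b) ^ 2) = (w b * p b) * (w b * (p b - q b) ^ 2) := by ring
      _ ≤ (w b * (q b + |p b - q b|)) * (w b * (p b - q b) ^ 2) := by
          gcongr
          · exact hterm b
          · exact hw0 b
      _ ≤ (1 + √(s * D / θ)) * (w b * (p b - q b) ^ 2) := by
          refine mul_le_mul_of_nonneg_right ?_ (hterm b)
          rw [mul_add]
          exact add_le_add (hwq b) h1
  have hθD : θ ≤ 2 * D := by linarith
  have hr : √(s * D / θ) ≤ 2 * m * D / K := by
    rw [Real.sqrt_le_left (by positivity), div_pow, div_le_div_iff₀ hθ (by positivity)]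
    have h1 : D * (K ^ 2 * s) ≤ D * (m * θ) ^ 2 := mul_le_mul_of_nonneg_left hsq hDpos.le
    have h2 : 0 ≤ m ^ 2 * D * θ * (4 * D - θ) := by
      have : 0 ≤ 4 * D - θ := by linarith
      positivity
    nlinarith
  have h1m : K ≤ 2 * m * D := by
    have : K * 1 ≤ K * √s := by gcongr; exact Real.one_le_sqrt.2 hs
    nlinarith
  have hA2 : K * ∑ b, p b ^ 2 * w b ^ 2 ≤ 12 * m ^ 2 * D ^ 2 := by
    have h1 : s ≤ 4 * m ^ 2 * D ^ 2 / K ^ 2 := by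
      rw [le_div_iff₀ (by positivity)]
      have : (m * θ) ^ 2 ≤ (m * (2 * D)) ^ 2 := by gcongr
      nlinarith
    have h2 : s / θ * D ≤ 2 * m ^ 2 * D ^ 2 / K ^ 2 := by
      rw [div_mul_eq_mul_div, div_le_div_iff₀ hθ (by positivity)]
      have h3 : D * (K ^ 2 * s) ≤ D * (m * θ) ^ 2 := mul_le_mul_of_nonneg_left hsq hDpos.le
      have h4 : 0 ≤ m ^ 2 * D * θ * (2 * D - θ) := by
        have : 0 ≤ 2 * D - θ := by linarith
        positivity
      nlinarith
    have h3 : 2 * s + 2 * (s / θ) * D ≤ 12 * m ^ 2 * D ^ 2 / K ^ 2 := by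
      have : 12 * m ^ 2 * D ^ 2 / K ^ 2 =
        2 * (4 * m ^ 2 * D ^ 2 / K ^ 2) + 2 * (2 * m ^ 2 * D ^ 2 / K ^ 2) := by ring
      rw [this]; linarith
    have h4 : 12 * m ^ 2 * D ^ 2 / K ^ 2 ≤ 12 * m ^ 2 * D ^ 2 / K := by
      gcongr; nlinarith
    have h5 := hA.trans (h3.trans h4)
    rwa [le_div_iff₀ (by positivity), mul_comm] at h5
  have hB2 : K * ∑ b, p b * (w b ^ 2 * (p b - q b) ^ 2) ≤ 4 * m * D ^ 2 := by
    have h1 : D + √(s * D / θ) * D ≤ D + 2 * m * D / K * D := by gcongr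
    have h2 : K * (D + 2 * m * D / K * D) = K * D + 2 * m * D ^ 2 := by
      field_simp
    have h3 := mul_le_mul_of_nonneg_left (hB.trans h1) (by linarith : 0 ≤ K)
    rw [h2] at h3
    nlinarith
  rw [div_mul_eq_mul_div, le_div_iff₀ (by linarith)]
  have h1 := mul_le_mul_of_nonneg_left hA2 (by positivity : (0 : ℝ) ≤ m ^ 2)
  have h2 := mul_le_mul_of_nonneg_left hB2 (by positivity : (0 : ℝ) ≤ 2 * m ^ 3)
  linarith

/-- Acceptance forces a deviation of at least `m ^ 2 * D / 2` from the mean, so Chebyshev's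
inequality multiplies the factor `20 / K` of `deviation_bound` by `4`. -/
theorem IsSampler.one_sub_rejectProb_identityTest_le [Nonempty β] (h : IsSampler π O p smp)
    (hq : ∀ b, 0 ≤ q b) (hθ : 0 < θ) (hm : 0 < m) (hK : 1 ≤ K)
    (hmK : K * √(Fintype.card β) ≤ m * θ)
    (hD : θ / 2 ≤ ∑ b, testWeight q θ b * (p b - q b) ^ 2) :
    1 - rejectProb (identityTest q θ m smp) π O ≤ 80 / K := by
  classical
  have hm' : (0 : ℝ) < m := by exact_mod_cast hm
  have hdev := (iidExp_pairingStat_le h.nonneg h.sum_eq_one q (testWeight q θ) m).trans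
    (deviation_bound hq hθ hm hK hmK hD)
  set D := ∑ b, testWeight q θ b * (p b - q b) ^ 2 with hDdef
  have hDpos : 0 < D := by linarith
  have hle : 1 - rejectProb (identityTest q θ m smp) π O ≤
      iidExp p m fun Y => iidExp p m fun X =>
        4 / (m ^ 4 * D ^ 2) * (pairingStat q (testWeight q θ) Y X - m ^ 2 * D) ^ 2 := by
    simp only [identityTest, h.rejectProb_drawList, rejectProb_done_ite]
    rw [sub_le_iff_le_add, ← iidExp_add]
    simp only [← iidExp_add]
    refine (iidExp_const h.sum_eq_one m 1).symm.trans_le (iidExp_mono h.nonneg m fun Y => ?_)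
    refine (iidExp_const h.sum_eq_one m 1).symm.trans_le ?_
    refine iidExp_mono h.nonneg m fun X => ?_
    split_ifs with hT
    · have : 0 ≤ 4 / (m ^ 4 * D ^ 2) *
        (pairingStat q (testWeight q θ) Y X - m ^ 2 * D) ^ 2 := by positivity
      linarith
    · rw [add_zero, div_mul_eq_mul_div, le_div_iff₀ (by positivity)]
      push Not at hT
      have h1 : m ^ 2 * θ / 4 ≤ m ^ 2 * D / 2 := by nlinarith [sq_nonneg (m : ℝ)]
      have h2 : m ^ 2 * D / 2 ≤ m ^ 2 * D - pairingStat q (testWeight q θ) Y X := by linarith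
      have h3 := pow_le_pow_left₀ (by positivity) h2 2
      nlinarith
  simp only [iidExp_mul_left] at hle
  refine hle.trans ((mul_le_mul_of_nonneg_left hdev (by positivity)).trans (le_of_eq ?_))
  have : 0 < K := by linarith
  field_simp
  ring

end Test

/-! ### From divergence to the test statistic -/

/-- The Kullback-Leibler divergence of two weight functions. -/
noncomputable def klSum {β : Type*} [Fintype β] (p q : β → ℝ) : ℝ :=
  ∑ b, p b * Real.log (p b / q b)

theorem half_le_log_inv {η : ℝ} (hη : 0 < η) (hη2 : η ≤ 1 / 2) : 1 / 2 ≤ Real.log (1 / η) := by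
  have h1 : Real.log 2 ≤ Real.log (1 / η) :=
    Real.log_le_log two_pos (by rw [le_div_iff₀ hη]; linarith)
  linarith [Real.log_two_gt_d9]

/-- The correction `- p + q` sums to zero over two distributions and makes each term quadratic near
`p = q`. If `p ≤ 2q`, use `log u ≤ u - 1`; otherwise `p` is comparable to `p - q` and the logarithm
is at most `log (1 / η)`. -/
theorem mul_log_div_sub_le {p q η : ℝ} (hp : 0 ≤ p) (hp1 : p ≤ 1) (hη : 0 < η) (hη2 : η ≤ 1 / 2)
    (hq : η ≤ q) :
    p * Real.log (p / q) - p + q ≤ 6 * Real.log (1 / η) * ((p - q) ^ 2 / (p + q)) := by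
  have hq0 : 0 < q := by linarith
  have hL := half_le_log_inv hη hη2
  set L := Real.log (1 / η)
  rw [mul_div_assoc', le_div_iff₀ (by linarith)]
  rcases le_or_gt p (2 * q) with h | h
  · have h1 : p * Real.log (p / q) ≤ p * (p / q - 1) := by
      rcases hp.eq_or_lt with rfl | hp'
      · simp
      · exact mul_le_mul_of_nonneg_left (Real.log_le_sub_one_of_pos (by positivity)) hp
    have h2 : p * (p / q - 1) - p + q = (p - q) ^ 2 / q := by field_simp; ring
    have h3 : (p - q) ^ 2 / q * (p + q) ≤ 3 * (p - q) ^ 2 := by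
      rw [div_mul_eq_mul_div, div_le_iff₀ hq0]
      nlinarith [sq_nonneg (p - q)]
    nlinarith [sq_nonneg (p - q)]
  · have h1 : p * Real.log (p / q) ≤ p * L := by
      refine mul_le_mul_of_nonneg_left (Real.log_le_log (by apply div_pos <;> linarith) ?_) hp
      rw [div_le_div_iff₀ hq0 hη]
      nlinarith
    have h2 : p * (p + q) ≤ 6 * (p - q) ^ 2 := by
      nlinarith [mul_nonneg (by linarith : 0 ≤ 5 * p - 3 * q) (by linarith : 0 ≤ p - 2 * q)]
    have h3 : (p * Real.log (p / q) - p + q) * (p + q) ≤ p * L * (p + q) := by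
      apply mul_le_mul_of_nonneg_right <;> linarith
    nlinarith

section

variable {β : Type*} [Fintype β] {p q : β → ℝ}

theorem klSum_le_log_inv {η : ℝ} (hp : ∀ b, 0 ≤ p b) (hp1 : ∑ b, p b = 1) (hη : 0 < η)
    (hq : ∀ b, η ≤ q b) : klSum p q ≤ Real.log (1 / η) := by
  have h1 : ∀ b, p b ≤ 1 := fun b =>
    hp1 ▸ Finset.single_le_sum (fun b _ => hp b) (Finset.mem_univ b)
  calc klSum p q ≤ ∑ b, p b * Real.log (1 / η) := by
        refine Finset.sum_le_sum fun b _ => ?_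
        rcases (hp b).eq_or_lt with h | h
        · simp [← h]
        · have hqb : 0 < q b := hη.trans_le (hq b)
          refine mul_le_mul_of_nonneg_left (Real.log_le_log (by positivity) ?_) (hp b)
          rw [div_le_div_iff₀ hqb hη]
          nlinarith [h1 b, hq b]
    _ = Real.log (1 / η) := by rw [← Finset.sum_mul, hp1, one_mul]

/-- With `c = θ / Fintype.card β`, points where `p + q ≥ c` have `q + c ≤ 2(p + q)`, so the weighted
square controls `(p - q)² / (p + q)`. The other points contribute at most `c` each, hence `θ` in
total. The choice `τ = 12 * L * θ` leaves half of the divergence after this loss. -/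
theorem half_le_sum_testWeight {η τ : ℝ} (hp : ∀ b, 0 ≤ p b) (hp1 : ∑ b, p b = 1)
    (hq1 : ∑ b, q b = 1) (hη : 0 < η) (hη2 : η ≤ 1 / 2) (hq : ∀ b, η ≤ q b) (hτ : 0 < τ)
    (h : τ ≤ klSum p q) :
    τ / (12 * Real.log (1 / η)) / 2 ≤
      ∑ b, testWeight q (τ / (12 * Real.log (1 / η))) b * (p b - q b) ^ 2 := by
  have hL := half_le_log_inv hη hη2
  set L := Real.log (1 / η) with hLdef
  set θ := τ / (12 * L) with hθdef
  have hθ : 0 < θ := by positivity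
  have hle1 : ∀ b, p b ≤ 1 := fun b =>
    hp1 ▸ Finset.single_le_sum (fun b _ => hp b) (Finset.mem_univ b)
  have hβ : Nonempty β := by
    by_contra hne
    rw [not_nonempty_iff] at hne
    simp at hp1
  have hterm : ∀ b, (p b - q b) ^ 2 / (p b + q b) ≤
      2 * (testWeight q θ b * (p b - q b) ^ 2) + θ / Fintype.card β := by
    intro b
    have hqb : 0 < q b := hη.trans_le (hq b)
    have hc : 0 < θ / Fintype.card β := by positivity
    have hpos : 0 < p b + q b := by linarith [hp b]
    rw [testWeight]
    set c := θ / Fintype.card β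
    rcases le_or_gt c (p b + q b) with h1 | h1
    · have h2 : (p b - q b) ^ 2 / (p b + q b) ≤ 2 * ((q b + c)⁻¹ * (p b - q b) ^ 2) := by
        rw [inv_mul_eq_div, mul_div_assoc', div_le_div_iff₀ hpos (by linarith)]
        nlinarith [sq_nonneg (p b - q b), hp b]
      linarith
    · have h2 : (p b - q b) ^ 2 / (p b + q b) ≤ c := by
        rw [div_le_iff₀ hpos]
        nlinarith [hp b, mul_nonneg (hp b) hqb.le]
      have : 0 ≤ 2 * ((q b + c)⁻¹ * (p b - q b) ^ 2) := by positivity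
      linarith
  have h1 : τ ≤ 6 * L * (2 * ∑ b, testWeight q θ b * (p b - q b) ^ 2 + θ) := by
    calc τ ≤ ∑ b, (p b * Real.log (p b / q b) - p b + q b) := by
          rw [Finset.sum_add_distrib, Finset.sum_sub_distrib, hp1, hq1]
          simpa [klSum] using h
      _ ≤ ∑ b, 6 * L * (2 * (testWeight q θ b * (p b - q b) ^ 2) + θ / Fintype.card β) := by
          refine Finset.sum_le_sum fun b _ => (mul_log_div_sub_le (hp b) (hle1 b) hη hη2
            (hq b)).trans ?_
          gcongr
          exact hterm b
      _ = _ := by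
          rw [← Finset.mul_sum, Finset.sum_add_distrib, ← Finset.mul_sum]
          simp [mul_div_cancel₀]
  have h2 : τ = 12 * L * θ := by rw [hθdef]; field_simp
  have h3 : 6 * L * (2 * θ) ≤ 6 * L * (2 * ∑ b, testWeight q θ b * (p b - q b) ^ 2 + θ) := by
    linarith
  have h4 := le_of_mul_le_mul_left h3 (by positivity)
  linarith

end

/-! ### Repeated tests with growing accuracy -/

section Stages

variable {n : ℕ} {S : Type u} {β : Type*} [Fintype β]

/-- The batch size for accuracy `K`. -/
noncomputable def batchSize (β : Type*) [Fintype β] (K θ : ℝ) : ℕ :=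
  ⌈K * √(Fintype.card β) / θ⌉₊

theorem batchSize_pos [Nonempty β] {K θ : ℝ} (hK : 0 < K) (hθ : 0 < θ) :
    0 < batchSize β K θ := by
  have : (0 : ℝ) < Fintype.card β := by exact_mod_cast Fintype.card_pos
  exact Nat.ceil_pos.2 (by positivity)

theorem le_batchSize_mul {K θ : ℝ} (hθ : 0 < θ) :
    K * √(Fintype.card β) ≤ batchSize β K θ * θ := by
  rw [← div_le_iff₀ hθ]
  exact Nat.le_ceil _

theorem one_le_sqrt_card_div [Nonempty β] {θ : ℝ} (hθ : 0 < θ) (hθ1 : θ ≤ 1) :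
    1 ≤ √(Fintype.card β) / θ := by
  rw [le_div_iff₀ hθ, one_mul]
  exact hθ1.trans (Real.one_le_sqrt.2 (Nat.one_le_cast.2 Fintype.card_pos))

/-- Rounding up costs at most `1`, a fraction `1 / 400` of the size: `2.005 = 2 * (1 + 1 / 400)`. -/
theorem two_mul_batchSize_le [Nonempty β] {K θ : ℝ} (hK : 400 ≤ K) (hθ : 0 < θ) (hθ1 : θ ≤ 1) :
    2 * (batchSize β K θ : ℝ) ≤ 2.005 * K * (√(Fintype.card β) / θ) := by
  have h1 := one_le_sqrt_card_div (β := β) hθ hθ1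
  have h2 := Nat.ceil_lt_add_one (a := K * √(Fintype.card β) / θ) (by positivity)
  rw [mul_div_assoc] at h2
  rw [batchSize, mul_div_assoc]
  nlinarith

/-- Repeat the identity test with growing accuracy, starting with stage `t`, until it accepts, but
at most the given number of times; reject if it never accepts. -/
noncomputable def stagedTest (q : β → ℝ) (θ : ℝ)
    (smp : (β → OracleAlg n S Verdict) → OracleAlg n S Verdict) : ℕ → ℕ → OracleAlg n S Verdict
  | 0, _ => done Verdict.reject
  | r + 1, t => onReject (identityTest q θ (batchSize β (400 * 4 ^ t) θ) smp)
      (stagedTest q θ smp r (t + 1))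

variable {π : PMF (Fin n → S)} {O : (Fin n → S) → Fin n → PMF (Fin n → S)}
  {p q : β → ℝ} {θ : ℝ}
  {smp : (β → OracleAlg n S Verdict) → OracleAlg n S Verdict} [Nonempty β]

theorem four_hundred_le (t : ℕ) : (400 : ℝ) ≤ 400 * 4 ^ t := by
  have : (1 : ℝ) ≤ 4 ^ t := one_le_pow₀ (by norm_num)
  linarith

theorem IsSampler.rejectProb_stage_le (h : IsSampler π O q smp) (hθ : 0 < θ) {K : ℝ}
    (hK : 400 ≤ K) :
    rejectProb (identityTest q θ (batchSize β K θ) smp) π O ≤ 1 / 8 := by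
  refine (h.rejectProb_identityTest_null hθ (batchSize_pos (by linarith) hθ) (by linarith)
    (le_batchSize_mul hθ)).trans ?_
  rw [div_le_div_iff₀ (by positivity) (by norm_num)]
  nlinarith

theorem IsSampler.rejectProb_stagedTest_null (h : IsSampler π O q smp) (hθ : 0 < θ) (r t : ℕ) :
    rejectProb (stagedTest q θ smp r t) π O ≤ (1 / 8) ^ r := by
  induction r generalizing t with
  | zero => simpa using rejectProb_le_one π O _
  | succ r ih =>
    rw [stagedTest, rejectProb_onReject, pow_succ, mul_comm]
    exact mul_le_mul (ih _) (h.rejectProb_stage_le hθ (four_hundred_le t))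
      (rejectProb_nonneg _ _ _) (by positivity)

/-- The next stage costs four times as much but is reached with probability at most `1 / 8`, so
expected costs halve geometrically: `802 + 1604 * 4 / 8 = 1604`. The bound does not depend on `r`,
which makes the null error as small as desired for free. -/
theorem IsSampler.expCalls_stagedTest_null (h : IsSampler π O q smp) (hθ : 0 < θ) (hθ1 : θ ≤ 1)
    (r t : ℕ) :
    (stagedTest q θ smp r t).expCalls π O ≤
      ENNReal.ofReal (1604 * 4 ^ t * (√(Fintype.card β) / θ)) := by
  induction r generalizing t with
  | zero => simp [stagedTest, expCalls]
  | succ r ih =>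
    rw [stagedTest, expCalls_onReject]
    have h1 : (identityTest q θ (batchSize β (400 * 4 ^ t) θ) smp).expCalls π O ≤
        ENNReal.ofReal (802 * 4 ^ t * (√(Fintype.card β) / θ)) := by
      refine h.expCalls_identityTest_le.trans ?_
      have h2 := two_mul_batchSize_le (β := β) (four_hundred_le t) hθ hθ1
      have h3 : (2 * (batchSize β (400 * 4 ^ t) θ : ℝ≥0∞)) =
          ENNReal.ofReal (2 * (batchSize β (400 * 4 ^ t) θ : ℝ)) := by
        rw [ENNReal.ofReal_mul (by norm_num)]; simp
      rw [h3]
      refine ENNReal.ofReal_le_ofReal (h2.trans (le_of_eq ?_))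
      ring
    have h2 : (identityTest q θ (batchSize β (400 * 4 ^ t) θ) smp).run π O Verdict.reject ≤
        ENNReal.ofReal (1 / 8) :=
      (ENNReal.le_ofReal_iff_toReal_le (PMF.apply_ne_top _ _) (by norm_num)).2
        (h.rejectProb_stage_le hθ (four_hundred_le t))
    refine (add_le_add h1 (mul_le_mul' h2 (ih (t + 1)))).trans ?_
    rw [← ENNReal.ofReal_mul (by norm_num), ← ENNReal.ofReal_add (by positivity) (by positivity)]
    refine ENNReal.ofReal_le_ofReal (le_of_eq ?_)
    ring

/-- Stage `t` wrongly accepts with probability at most `80 / (400 * 4 ^ t)`, and `1 / 5 + 1 / 3 * 1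
/ 4 ≤ 1 / 3` closes the induction. -/
theorem IsSampler.one_sub_rejectProb_stagedTest_le (h : IsSampler π O p smp) (hq : ∀ b, 0 ≤ q b)
    (hθ : 0 < θ) (hD : θ / 2 ≤ ∑ b, testWeight q θ b * (p b - q b) ^ 2) (r t : ℕ) :
    1 - rejectProb (stagedTest q θ smp r t) π O ≤ 1 / 3 * (1 / 4) ^ t := by
  induction r generalizing t with
  | zero => simp [stagedTest, rejectProb, run]
  | succ r ih =>
    rw [stagedTest, rejectProb_onReject]
    have hK := four_hundred_le t
    have h1 := h.one_sub_rejectProb_identityTest_le hq hθ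
      (batchSize_pos (β := β) (by linarith : (0 : ℝ) < 400 * 4 ^ t) hθ) (by linarith)
      (le_batchSize_mul hθ) hD
    have h2 := ih (t + 1)
    have h3 : 80 / (400 * 4 ^ t : ℝ) = 1 / 5 * (1 / 4) ^ t := by
      rw [one_div_pow]; field_simp; norm_num
    rw [h3] at h1
    rw [pow_succ] at h2
    have h4 : (0 : ℝ) < (1 / 4) ^ t := by positivity
    have h5 := rejectProb_le_one π O
      (identityTest q θ (batchSize β (400 * 4 ^ t) θ) smp)
    have h6 := rejectProb_le_one π O (stagedTest q θ smp r (t + 1))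
    nlinarith [mul_nonneg (sub_nonneg.2 h5) (sub_nonneg.2 h6)]

end Stages

/-! ### Discrete divergence and the variational formula for entropy. -/

theorem sum_toReal_eq_one {Ω : Type*} [Fintype Ω] (μ : PMF Ω) : ∑ x, (μ x).toReal = 1 := by
  have h := μ.tsum_coe
  rw [tsum_fintype] at h
  rw [← ENNReal.toReal_sum fun x _ => PMF.apply_ne_top _ _, h, ENNReal.toReal_one]

theorem klDiv_le_klSum {Ω : Type*} [Fintype Ω] (π μ : PMF Ω) (hμ : ∀ x, μ x ≠ 0) :
    IdentityTesting.klDiv π μ ≤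
      ENNReal.ofReal (klSum (fun x => (π x).toReal) fun x => (μ x).toReal) := by
  let _ : MeasurableSpace Ω := ⊤
  have hms : MeasurableSingletonClass Ω := ⟨fun _ => trivial⟩
  have hd : π.toMeasure = μ.toMeasure.withDensity fun x => π x / μ x := by
    refine MeasureTheory.Measure.ext_of_singleton fun x => ?_
    rw [MeasureTheory.withDensity_apply _ (measurableSet_singleton x),
      MeasureTheory.lintegral_singleton,
      PMF.toMeasure_apply_singleton _ _ (measurableSet_singleton x),
      PMF.toMeasure_apply_singleton _ _ (measurableSet_singleton x),
      ENNReal.div_mul_cancel (hμ x) (PMF.apply_ne_top _ _)]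
  have hrn : ∀ x, π.toMeasure.rnDeriv μ.toMeasure x = π x / μ x := by
    intro x
    have h := MeasureTheory.Measure.rnDeriv_withDensity μ.toMeasure
      (f := fun x => π x / μ x) (fun _ _ => trivial)
    rw [← hd] at h
    rw [Filter.EventuallyEq, MeasureTheory.ae_iff,
      PMF.toMeasure_apply_eq_zero_iff _ MeasurableSpace.measurableSet_top, Set.disjoint_right] at h
    by_contra hx
    exact h hx ((PMF.mem_support_iff _ _).2 (hμ x))
  have hac : π.toMeasure.AbsolutelyContinuous μ.toMeasure := by
    rw [hd]; exact MeasureTheory.withDensity_absolutelyContinuous _ _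
  have hint : MeasureTheory.Integrable (MeasureTheory.llr π.toMeasure μ.toMeasure)
      π.toMeasure := MeasureTheory.Integrable.of_finite
  rw [IdentityTesting.klDiv, InformationTheory.klDiv_of_ac_of_integrable hac hint,
    PMF.integral_eq_sum]
  refine ENNReal.ofReal_le_ofReal (le_of_eq ?_)
  simp [MeasureTheory.llr, hrn, klSum, ENNReal.toReal_div]

section Ent

variable {Ω : Type*} [Fintype Ω] {w f : Ω → ℝ}

theorem ent_eq_sum (hw : ∑ x, w x = 1) :
    ent w f = ∑ x, w x * (f x * Real.log (f x) - f x * Real.log (∑ x, w x * f x) - f x +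
      ∑ x, w x * f x) := by
  set t := ∑ x, w x * f x with ht
  have h : ∀ x, w x * (f x * Real.log (f x) - f x * Real.log t - f x + t) =
      w x * (f x * Real.log (f x)) - w x * f x * Real.log t - w x * f x + w x * t := by
    intro x; ring
  simp only [h, Finset.sum_add_distrib, Finset.sum_sub_distrib, ← Finset.sum_mul, hw, ← ht]
  simp [ent, ← ht]

/-- The entropy is the minimum over `t` of an expression linear in `w`, attained at the mean
(`ent_eq_sum`). The condition `ht0` excludes a false bound at `t = 0`, where `Real.log 0 = 0`. -/
theorem ent_le_sum (hw0 : ∀ x, 0 ≤ w x) (hw : ∑ x, w x = 1) (hf : ∀ x, 0 ≤ f x) {t : ℝ}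
    (ht : 0 ≤ t) (ht0 : t = 0 → ∑ x, w x * f x = 0) :
    ent w f ≤ ∑ x, w x * (f x * Real.log (f x) - f x * Real.log t - f x + t) := by
  have h : ∀ x, w x * (f x * Real.log (f x) - f x * Real.log t - f x + t) =
      w x * (f x * Real.log (f x)) - w x * f x * Real.log t - w x * f x + w x * t := by
    intro x; ring
  simp only [h, Finset.sum_add_distrib, Finset.sum_sub_distrib, ← Finset.sum_mul, hw]
  have hs : 0 ≤ ∑ x, w x * f x := Finset.sum_nonneg fun x _ => mul_nonneg (hw0 x) (hf x)
  rw [ent]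
  set s := ∑ x, w x * f x
  rcases hs.eq_or_lt with h0 | hs
  · rw [← h0]; simp [ht]
  · have ht' : 0 < t := ht.lt_of_ne fun h => hs.ne' (ht0 h.symm)
    have h1 := Real.log_le_sub_one_of_pos (div_pos ht' hs)
    rw [Real.log_div ht'.ne' hs.ne'] at h1
    have h2 := mul_le_mul_of_nonneg_left h1 hs.le
    have h3 : s * (t / s - 1) = t - s := by field_simp
    linarith

end Ent

/-! ### Lines, local entropy and the divergence of a mixture. -/

section Line

variable {n : ℕ} {S : Type u}

theorem mem_line_iff_update {x y : Fin n → S} {i : Fin n} :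
    y ∈ line x i ↔ Function.update x i (y i) = y := by
  constructor
  · intro h
    ext j
    by_cases hj : j = i
    · subst hj; simp
    · rw [Function.update_of_ne hj, h j hj]
  · intro h j hj
    rw [← h, Function.update_of_ne hj]

theorem mem_line_comm {x y : Fin n → S} {i : Fin n} : y ∈ line x i ↔ x ∈ line y i :=
  forall₂_congr fun _ _ => eq_comm

theorem update_eq_of_mem_line {x y : Fin n → S} {i : Fin n} (h : y ∈ line x i) (b : S) :
    Function.update y i b = Function.update x i b := by
  ext j
  by_cases hj : j = i
  · subst hj; simp
  · simp [Function.update_of_ne hj, h j hj]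

theorem update_mem_line (x : Fin n → S) (i : Fin n) (b : S) :
    Function.update x i b ∈ line x i := fun _ hj => Function.update_of_ne hj _ _

theorem line_eq_of_mem {x y : Fin n → S} {i : Fin n} (h : y ∈ line x i) :
    line y i = line x i := by
  ext z
  exact forall₂_congr fun j hj => by rw [h j hj]

variable [Fintype S]

open Classical in
theorem sum_line (x : Fin n → S) (i : Fin n) (F : (Fin n → S) → ℝ) :
    ∑ y, (if y ∈ line x i then F y else 0) = ∑ b, F (Function.update x i b) := by
  rw [← Finset.sum_filter]
  refine Finset.sum_nbij' (fun y => y i) (fun b => Function.update x i b) (by simp) ?_ ?_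
    (by simp) ?_
  · intro b _
    simpa using update_mem_line x i b
  · intro y hy
    exact mem_line_iff_update.1 (by simpa using hy)
  · intro y hy
    rw [mem_line_iff_update.1 (by simpa using hy)]

variable (μ : PMF (Fin n → S))

theorem lineMass_eq_of_mem {x y : Fin n → S} {i : Fin n} (h : y ∈ line x i) :
    lineMass μ y i = lineMass μ x i := by
  simp only [lineMass, update_eq_of_mem_line h]

theorem condLine_eq_of_mem {x y : Fin n → S} {i : Fin n} (h : y ∈ line x i) :
    condLine μ y i = condLine μ x i := by
  ext z
  rw [condLine, condLine, line_eq_of_mem h, lineMass_eq_of_mem μ h]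

theorem lineMass_nonneg (x : Fin n → S) (i : Fin n) : 0 ≤ lineMass μ x i :=
  Finset.sum_nonneg fun _ _ => ENNReal.toReal_nonneg

theorem le_lineMass (x : Fin n → S) (i : Fin n) : (μ x).toReal ≤ lineMass μ x i := by
  have h := Finset.single_le_sum (f := fun b => (μ (Function.update x i b)).toReal)
    (fun b _ => ENNReal.toReal_nonneg) (Finset.mem_univ (x i))
  rwa [Function.update_eq_self] at h

theorem condLine_nonneg (x : Fin n → S) (i : Fin n) (y : Fin n → S) : 0 ≤ condLine μ x i y := by
  rw [condLine]
  split_ifs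
  · exact div_nonneg ENNReal.toReal_nonneg (lineMass_nonneg _ _ _)
  · exact le_rfl

theorem condLine_update (x : Fin n → S) (i : Fin n) (b : S) :
    condLine μ x i (Function.update x i b) =
      (μ (Function.update x i b)).toReal / lineMass μ x i :=
  if_pos (update_mem_line x i b)

theorem sum_condLine_mul (x : Fin n → S) (i : Fin n) (F : (Fin n → S) → ℝ) :
    ∑ y, condLine μ x i y * F y =
      ∑ b, condLine μ x i (Function.update x i b) * F (Function.update x i b) := by
  classical
  rw [← sum_line x i fun y => condLine μ x i y * F y]
  refine Finset.sum_congr rfl fun y _ => ?_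
  split_ifs with h
  · rfl
  · rw [condLine, if_neg h, zero_mul]

theorem sum_condLine_update {x : Fin n → S} {i : Fin n} (h : 0 < lineMass μ x i) :
    ∑ b, condLine μ x i (Function.update x i b) = 1 := by
  simp only [condLine_update, ← Finset.sum_div]
  exact div_self h.ne'

theorem sum_condLine {x : Fin n → S} {i : Fin n} (h : 0 < lineMass μ x i) :
    ∑ y, condLine μ x i y = 1 := by
  have := sum_condLine_mul μ x i fun _ => 1
  simpa [sum_condLine_update μ h] using this

/-- Resampling one coordinate from its conditional law preserves `μ`. -/
theorem sum_mul_sum_condLine (i : Fin n) (H : (Fin n → S) → ℝ) :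
    ∑ x, (μ x).toReal * ∑ y, condLine μ x i y * H y = ∑ y, (μ y).toReal * H y := by
  classical
  simp only [Finset.mul_sum]
  rw [Finset.sum_comm]
  refine Finset.sum_congr rfl fun y _ => ?_
  have h : ∀ x, (μ x).toReal * (condLine μ x i y * H y) =
      (if x ∈ line y i then (μ x).toReal * ((μ y).toReal / lineMass μ y i * H y) else 0) := by
    intro x
    rw [condLine]
    by_cases hx : y ∈ line x i
    · rw [if_pos hx, if_pos (mem_line_comm.1 hx), lineMass_eq_of_mem μ hx]
    · rw [if_neg hx, if_neg (mem_line_comm.not.1 hx)]; simp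
  simp only [h]
  rw [sum_line, ← Finset.sum_mul]
  change lineMass μ y i * _ = _
  rcases (lineMass_nonneg μ y i).eq_or_lt with h0 | h0
  · have := le_lineMass μ y i
    have h1 : (μ y).toReal = 0 := le_antisymm (h0 ▸ this) ENNReal.toReal_nonneg
    simp [h1]
  · field_simp

/-- The divergence of the conditional distributions of `π` and `μ` on a line. -/
noncomputable def lineKL (π μ : PMF (Fin n → S)) (x : Fin n → S) (i : Fin n) : ℝ :=
  klSum (fun b => condLine π x i (Function.update x i b))
    fun b => condLine μ x i (Function.update x i b)

variable {μ} (hμ : ∀ x, μ x ≠ 0)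
include hμ

omit [Fintype S] in
theorem toReal_pos_of_support (x : Fin n → S) : 0 < (μ x).toReal :=
  ENNReal.toReal_pos (hμ x) (PMF.apply_ne_top _ _)

theorem lineMass_pos_of_support (x : Fin n → S) (i : Fin n) : 0 < lineMass μ x i :=
  (toReal_pos_of_support hμ x).trans_le (le_lineMass μ x i)

/-- Entropy is homogeneous: divided by its mean on the line, the density of `π` with respect to `μ`
becomes that of the conditional laws. -/
theorem ent_condLine_div (π : PMF (Fin n → S)) (x : Fin n → S) (i : Fin n) :
    ent (condLine μ x i) (fun y => (π y).toReal / (μ y).toReal) =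
      (∑ y, condLine μ x i y * ((π y).toReal / (μ y).toReal)) * lineKL π μ x i := by
  have hM := lineMass_pos_of_support hμ x i
  have hμ' := toReal_pos_of_support hμ
  have ht : ∑ y, condLine μ x i y * ((π y).toReal / (μ y).toReal) =
      lineMass π x i / lineMass μ x i := by
    rw [sum_condLine_mul, lineMass, Finset.sum_div]
    refine Finset.sum_congr rfl fun b _ => ?_
    rw [condLine_update]
    have := hμ' (Function.update x i b)
    field_simp
  rw [ent, ht, sum_condLine_mul, lineKL, klSum]
  simp only [condLine_update]
  rcases (lineMass_nonneg π x i).eq_or_lt with h0 | h0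
  · have h1 : ∀ b, (π (Function.update x i b)).toReal = 0 := fun b => by
      have := le_lineMass π (Function.update x i b) i
      rw [lineMass_eq_of_mem π (update_mem_line x i b), ← h0] at this
      exact le_antisymm this ENNReal.toReal_nonneg
    simp [h1, ← h0]
  · set t := lineMass π x i / lineMass μ x i with htdef
    have htpos : 0 < t := div_pos h0 hM
    have hb : ∀ b, (μ (Function.update x i b)).toReal / lineMass μ x i *
        ((π (Function.update x i b)).toReal / (μ (Function.update x i b)).toReal *
          Real.log ((π (Function.update x i b)).toReal / (μ (Function.update x i b)).toReal)) =
        (π (Function.update x i b)).toReal * (Real.log t / lineMass μ x i) +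
        t * ((π (Function.update x i b)).toReal / lineMass π x i *
          Real.log ((π (Function.update x i b)).toReal / lineMass π x i /
            ((μ (Function.update x i b)).toReal / lineMass μ x i))) := by
      intro b
      have h2 := hμ' (Function.update x i b)
      rcases (ENNReal.toReal_nonneg (a := π (Function.update x i b))).eq_or_lt with h3 | h3
      · simp [← h3]
      · set P := (π (Function.update x i b)).toReal
        set Q := (μ (Function.update x i b)).toReal
        have h4 : P / Q = t * (P / lineMass π x i / (Q / lineMass μ x i)) := by
          rw [htdef]; field_simp
        rw [h4, Real.log_mul htpos.ne' (by positivity), ← h4, htdef]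
        field_simp
    simp only [hb, Finset.sum_add_distrib, ← Finset.mul_sum, ← Finset.sum_mul]
    change lineMass π x i * _ + _ - _ = _
    rw [htdef]
    ring

/-- `lineKL` is constant on each line, so it passes inside the conditional mean. Invariance under
resampling then leaves a `μ`-average weighted by `π / μ`, that is, a `π`-average. -/
theorem localEnt_div (π : PMF (Fin n → S)) :
    localEnt μ (fun y => (π y).toReal / (μ y).toReal) =
      ∑ i, ∑ x, (π x).toReal * lineKL π μ x i := by
  rw [localEnt]
  refine Finset.sum_congr rfl fun i _ => ?_
  have hconst : ∀ x y, condLine μ x i y * ((π y).toReal / (μ y).toReal) * lineKL π μ x i =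
      condLine μ x i y * ((π y).toReal / (μ y).toReal * lineKL π μ y i) := by
    intro x y
    by_cases h : y ∈ line x i
    · have : lineKL π μ y i = lineKL π μ x i := by
        simp only [lineKL, condLine_eq_of_mem _ h, update_eq_of_mem_line h]
      rw [this, mul_assoc]
    · simp [condLine, if_neg h]
  simp only [ent_condLine_div hμ, Finset.sum_mul, hconst]
  rw [sum_mul_sum_condLine μ i fun y => (π y).toReal / (μ y).toReal * lineKL π μ y i]
  refine Finset.sum_congr rfl fun y _ => ?_
  have := toReal_pos_of_support hμ y
  field_simp

/-- Use the line means `t` of `μ` as trial values in the variational formula for every component.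
The resulting integrand `H` is the same for all components, and its mean is linear in the measure;
for `μ` itself the trial value is optimal. -/
theorem sum_localEnt_le {k : ℕ} {ρ : Fin k → ℝ} {μs : Fin k → PMF (Fin n → S)}
    (hρ : ∀ a, 0 ≤ ρ a) (hmix : ∀ x, (μ x).toReal = ∑ a, ρ a * (μs a x).toReal)
    {f : (Fin n → S) → ℝ} (hf : ∀ x, 0 ≤ f x) :
    ∑ a, ρ a * localEnt (μs a) f ≤ localEnt μ f := by
  simp only [localEnt, Finset.mul_sum (Finset.univ : Finset (Fin n))]
  rw [Finset.sum_comm]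
  refine Finset.sum_le_sum fun i _ => ?_
  set t : (Fin n → S) → ℝ := fun x => ∑ y, condLine μ x i y * f y with ht
  have ht0 : ∀ x, 0 ≤ t x := fun x =>
    Finset.sum_nonneg fun y _ => mul_nonneg (condLine_nonneg _ _ _ _) (hf y)
  set H : (Fin n → S) → ℝ := fun y =>
    f y * Real.log (f y) - f y * Real.log (t y) - f y + t y with hH
  have hline : ∀ (ν : PMF (Fin n → S)) x,
      ∑ y, condLine ν x i y * (f y * Real.log (f y) - f y * Real.log (t x) - f y + t x) =
        ∑ y, condLine ν x i y * H y := by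
    intro ν x
    refine Finset.sum_congr rfl fun y _ => ?_
    by_cases h : y ∈ line x i
    · have : t y = t x := by simp only [ht, condLine_eq_of_mem _ h]
      rw [hH]; simp only [this]
    · simp [condLine, if_neg h]
  have hle : ∀ (ν : PMF (Fin n → S)) x,
      ent (condLine ν x i) f ≤ ∑ y, condLine ν x i y * H y := by
    intro ν x
    rw [← hline]
    rcases (lineMass_nonneg ν x i).eq_or_lt with h0 | h0
    · have : ∀ y, condLine ν x i y = 0 := fun y => by simp [condLine, ← h0]
      simp [ent, this]
    · refine ent_le_sum (condLine_nonneg _ _ _) (sum_condLine ν h0) hf (ht0 x) fun h => ?_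
      rw [sum_condLine_mul]
      refine Finset.sum_eq_zero fun b _ => ?_
      simp only [ht] at h
      rw [sum_condLine_mul, Finset.sum_eq_zero_iff_of_nonneg
        fun b _ => mul_nonneg (condLine_nonneg _ _ _ _) (hf _)] at h
      have h1 := h b (Finset.mem_univ b)
      have h2 : condLine μ x i (Function.update x i b) ≠ 0 := by
        rw [condLine_update]
        exact (div_pos (toReal_pos_of_support hμ _) (lineMass_pos_of_support hμ x i)).ne'
      rw [(mul_eq_zero.1 h1).resolve_left h2, mul_zero]
  have heq : ∀ x, ent (condLine μ x i) f = ∑ y, condLine μ x i y * H y := by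
    intro x
    rw [← hline, ent_eq_sum (sum_condLine μ (lineMass_pos_of_support hμ x i))]
  calc ∑ a, ρ a * ∑ x, (μs a x).toReal * ent (condLine (μs a) x i) f
      ≤ ∑ a, ρ a * ∑ x, (μs a x).toReal * ∑ y, condLine (μs a) x i y * H y := by
        refine Finset.sum_le_sum fun a _ => mul_le_mul_of_nonneg_left
          (Finset.sum_le_sum fun x _ => ?_) (hρ a)
        exact mul_le_mul_of_nonneg_left (hle _ _) ENNReal.toReal_nonneg
    _ = ∑ a, ρ a * ∑ y, (μs a y).toReal * H y := by simp only [sum_mul_sum_condLine]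
    _ = ∑ y, (μ y).toReal * H y := by
        simp only [hmix, Finset.mul_sum, Finset.sum_mul]
        rw [Finset.sum_comm]
        exact Finset.sum_congr rfl fun y _ => Finset.sum_congr rfl fun a _ => by ring
    _ = ∑ x, (μ x).toReal * ent (condLine μ x i) f := by
        simp only [heq, sum_mul_sum_condLine]

/-- The chain rule for entropy over the mixture; `ρ a * g a` is the probability that a posterior
label of a sample of `π` equals `a`. -/
theorem klSum_mixture_le {k : ℕ} {ρ : Fin k → ℝ} {μs : Fin k → PMF (Fin n → S)} {c : ℝ}
    (hρ : ∀ a, 0 < ρ a) (hmix : ∀ x, (μ x).toReal = ∑ a, ρ a * (μs a x).toReal)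
    (hc : 0 ≤ c) (hate : ∀ a, IsATE c (μs a)) (π : PMF (Fin n → S)) :
    klSum (fun x => (π x).toReal) (fun x => (μ x).toReal) ≤
      klSum (fun a => ∑ x, (π x).toReal * (ρ a * (μs a x).toReal / (μ x).toReal)) ρ +
        c * ∑ i, ∑ x, (π x).toReal * lineKL π μ x i := by
  have hμ' := toReal_pos_of_support hμ
  set f : (Fin n → S) → ℝ := fun y => (π y).toReal / (μ y).toReal with hf
  have hf0 : ∀ x, 0 ≤ f x := fun x => div_nonneg ENNReal.toReal_nonneg ENNReal.toReal_nonneg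
  rw [← localEnt_div hμ]
  set g : Fin k → ℝ := fun a => ∑ x, (μs a x).toReal * f x with hg
  have h1 : klSum (fun x => (π x).toReal) (fun x => (μ x).toReal) =
      ∑ a, ρ a * ∑ x, (μs a x).toReal * (f x * Real.log (f x)) := by
    simp only [klSum, Finset.mul_sum]
    rw [Finset.sum_comm]
    refine Finset.sum_congr rfl fun x _ => ?_
    simp only [← mul_assoc, ← Finset.sum_mul, ← hmix]
    rw [hf]
    have := hμ' x
    field_simp
  have h2 : klSum (fun a => ∑ x, (π x).toReal * (ρ a * (μs a x).toReal / (μ x).toReal)) ρ =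
      ∑ a, ρ a * (g a * Real.log (g a)) := by
    refine Finset.sum_congr rfl fun a _ => ?_
    have : ∑ x, (π x).toReal * (ρ a * (μs a x).toReal / (μ x).toReal) = ρ a * g a := by
      rw [hg, Finset.mul_sum]
      exact Finset.sum_congr rfl fun x _ => by rw [hf]; ring
    simp only [this]
    rw [mul_div_cancel_left₀ _ (hρ a).ne', mul_assoc]
  have h3 : ∑ a, ρ a * ent (fun x => (μs a x).toReal) f ≤ c * localEnt μ f := by
    calc _ ≤ ∑ a, ρ a * (c * localEnt (μs a) f) :=
          Finset.sum_le_sum fun a _ => mul_le_mul_of_nonneg_left (hate a f hf0) (hρ a).le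
      _ = c * ∑ a, ρ a * localEnt (μs a) f := by
          rw [Finset.mul_sum]; exact Finset.sum_congr rfl fun a _ => by ring
      _ ≤ _ := mul_le_mul_of_nonneg_left (sum_localEnt_le hμ (fun a => (hρ a).le) hmix hf0) hc
  have h4 : ∑ a, ρ a * ent (fun x => (μs a x).toReal) f =
      ∑ a, ρ a * ∑ x, (μs a x).toReal * (f x * Real.log (f x)) -
        ∑ a, ρ a * (g a * Real.log (g a)) := by
    rw [← Finset.sum_sub_distrib]
    exact Finset.sum_congr rfl fun a _ => by rw [ent, mul_sub]
  rw [h1, h2]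
  linarith

end Line

theorem toReal_bind_apply {α R : Type*} [Fintype α] (p : PMF α) (g : α → PMF R) (r : R) :
    (p.bind g r).toReal = ∑ a, (p a).toReal * (g a r).toReal := by
  rw [PMF.bind_apply, tsum_fintype, ENNReal.toReal_sum fun a _ =>
    ENNReal.mul_ne_top (PMF.apply_ne_top _ _) (PMF.apply_ne_top _ _)]
  simp only [ENNReal.toReal_mul]

theorem tsum_mul_le_of_forall_le {α : Type*} (p : PMF α) {f : α → ℝ≥0∞} {c : ℝ≥0∞}
    (h : ∀ a, f a ≤ c) : ∑' a, p a * f a ≤ c := by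
  calc ∑' a, p a * f a ≤ ∑' a, p a * c := ENNReal.tsum_le_tsum fun a => mul_le_mul_right (h a) _
    _ = c := by rw [ENNReal.tsum_mul_right, p.tsum_coe, one_mul]

/-! ### The two oracles as samplers. -/

section

variable {n : ℕ} {S : Type u} [Fintype S] {π μ : PMF (Fin n → S)}
  {O : (Fin n → S) → Fin n → PMF (Fin n → S)}

/-- The procedure that passes to its continuation the new value of the coordinate `i` from a call
`(x, i)` of the Coordinate Oracle. -/
def coordSampler (x : Fin n → S) (i : Fin n) (f : S → OracleAlg n S Verdict) :
    OracleAlg n S Verdict :=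
  coord x i fun z => f (z i)

theorem isSampler_coordSampler (hO : IsCoordinateOracle π O) {x : Fin n → S} {i : Fin n}
    (hx : 0 < lineMass π x i) :
    IsSampler π O (fun b => condLine π x i (Function.update x i b)) (coordSampler x i) where
  nonneg b := condLine_nonneg π x i _
  sum_eq_one := sum_condLine_update π hx
  reject f := by
    have h := sum_condLine_mul π x i fun z => rejectProb (f (z i)) π O
    simp only [Function.update_self] at h
    rw [← h]
    simp only [rejectProb, coordSampler, run, toReal_bind_apply, hO x i hx]
  cost f c hf := by
    simp only [coordSampler, expCalls]
    gcongr
    exact tsum_mul_le_of_forall_le _ fun z => hf _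

/-- The procedure that calls the General Oracle and passes to its continuation a sample of the
given law for the answer. -/
noncomputable def labelSampler {k : ℕ} (post : (Fin n → S) → PMF (Fin k))
    (f : Fin k → OracleAlg n S Verdict) : OracleAlg n S Verdict :=
  general fun x => coin (post x) f

theorem isSampler_labelSampler {k : ℕ} (post : (Fin n → S) → PMF (Fin k)) :
    IsSampler π O (fun a => ∑ x, (π x).toReal * (post x a).toReal) (labelSampler post) where
  nonneg a := Finset.sum_nonneg fun x _ => mul_nonneg ENNReal.toReal_nonneg ENNReal.toReal_nonneg
  sum_eq_one := by
    rw [Finset.sum_comm]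
    simp only [← Finset.mul_sum, sum_toReal_eq_one, mul_one]
  reject f := by
    simp only [rejectProb, labelSampler, run, toReal_bind_apply, Finset.mul_sum, Finset.sum_mul]
    rw [Finset.sum_comm]
    simp only [mul_assoc]
  cost f c hf := by
    simp only [labelSampler, expCalls]
    gcongr
    exact tsum_mul_le_of_forall_le _ fun x => tsum_mul_le_of_forall_le _ hf

end

/-! ### Sequences of tests -/

section Sequence

variable {n : ℕ} {S : Type u}

/-- Run the first `J` of a sequence of tests, and reject if one of them rejects. -/
def sequenceTest (T : ℕ → OracleAlg n S Verdict) : ℕ → OracleAlg n S Verdict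
  | 0 => done Verdict.accept
  | J + 1 => onAccept (T J) (sequenceTest T J)

variable (π : PMF (Fin n → S)) (O : (Fin n → S) → Fin n → PMF (Fin n → S))

theorem rejectProb_accept : rejectProb (done Verdict.accept : OracleAlg n S Verdict) π O = 0 := by
  simp [rejectProb, run]

theorem rejectProb_onAccept_le (A B : OracleAlg n S Verdict) :
    rejectProb (onAccept A B) π O ≤ rejectProb A π O + rejectProb B π O := by
  have h := rejectProb_onAccept π O A B
  nlinarith [mul_nonneg (rejectProb_nonneg π O A) (rejectProb_nonneg π O B)]

theorem rejectProb_sequenceTest_le (T : ℕ → OracleAlg n S Verdict) (J : ℕ) :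
    rejectProb (sequenceTest T J) π O ≤ ∑ j ∈ Finset.range J, rejectProb (T j) π O := by
  induction J with
  | zero => simp [sequenceTest, rejectProb_accept]
  | succ J ih =>
    rw [Finset.sum_range_succ, sequenceTest, add_comm]
    exact (rejectProb_onAccept_le _ _ _ _).trans (by gcongr)

theorem expCalls_sequenceTest_le (T : ℕ → OracleAlg n S Verdict) (J : ℕ) :
    (sequenceTest T J).expCalls π O ≤ ∑ j ∈ Finset.range J, (T j).expCalls π O := by
  induction J with
  | zero => simp [sequenceTest, expCalls]
  | succ J ih =>
    rw [Finset.sum_range_succ, sequenceTest, add_comm]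
    exact (expCalls_onAccept_le _ _ _ _).trans (by gcongr)

theorem one_sub_rejectProb_sequenceTest_le (T : ℕ → OracleAlg n S Verdict) (J : ℕ) {r : ℕ → ℝ}
    (hr : ∀ j < J, 1 - rejectProb (T j) π O ≤ Real.exp (-r j)) :
    1 - rejectProb (sequenceTest T J) π O ≤ Real.exp (-∑ j ∈ Finset.range J, r j) := by
  induction J with
  | zero => simp [sequenceTest, rejectProb_accept]
  | succ J ih =>
    rw [Finset.sum_range_succ, sequenceTest, rejectProb_onAccept, neg_add_rev, Real.exp_add]
    exact mul_le_mul (hr J J.lt_succ_self) (ih fun j hj => hr j (hj.trans J.lt_succ_self))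
      (sub_nonneg.2 (rejectProb_le_one _ _ _)) (Real.exp_pos _).le

end Sequence

/-! ### The test on random lines -/

section Lines

variable {n : ℕ} {S : Type u} [Fintype S] {π μ : PMF (Fin n → S)}
  {O : (Fin n → S) → Fin n → PMF (Fin n → S)}

/-- Test the conditional distribution on the line through a sample in a random direction. -/
noncomputable def lineTest [NeZero n] (μ : PMF (Fin n → S)) (θ : ℝ) (r : ℕ) :
    OracleAlg n S Verdict :=
  coin (PMF.uniformOfFintype (Fin n)) fun i => general fun x =>
    stagedTest (fun b => condLine μ x i (Function.update x i b)) θ (coordSampler x i) r 0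

theorem rejectProb_lineTest [NeZero n] (θ : ℝ) (r : ℕ) :
    rejectProb (lineTest μ θ r) π O = ∑ i : Fin n, (n : ℝ)⁻¹ * ∑ x, (π x).toReal *
      rejectProb (stagedTest (fun b => condLine μ x i (Function.update x i b)) θ
        (coordSampler x i) r 0) π O := by
  simp only [rejectProb, lineTest, run, toReal_bind_apply, PMF.uniformOfFintype_apply,
    ENNReal.toReal_inv, ENNReal.toReal_natCast, Fintype.card_fin]

theorem rejectProb_lineTest_null [NeZero n] [Nonempty S] (hμ : ∀ x, μ x ≠ 0)
    (hO : IsCoordinateOracle μ O) {θ : ℝ} (hθ : 0 < θ) (r : ℕ) :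
    rejectProb (lineTest μ θ r) μ O ≤ (1 / 8) ^ r := by
  rw [rejectProb_lineTest]
  calc _ ≤ ∑ i : Fin n, (n : ℝ)⁻¹ * ∑ x, (μ x).toReal * (1 / 8) ^ r := by
        refine Finset.sum_le_sum fun i _ => mul_le_mul_of_nonneg_left
          (Finset.sum_le_sum fun x _ => mul_le_mul_of_nonneg_left ?_ ENNReal.toReal_nonneg)
          (by positivity)
        exact (isSampler_coordSampler hO
          (lineMass_pos_of_support hμ x i)).rejectProb_stagedTest_null hθ r 0
    _ = (1 / 8) ^ r := by
        simp [← Finset.sum_mul, sum_toReal_eq_one, NeZero.ne n]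

theorem expCalls_lineTest_null [NeZero n] [Nonempty S] (hμ : ∀ x, μ x ≠ 0)
    (hO : IsCoordinateOracle μ O) {θ : ℝ} (hθ : 0 < θ) (hθ1 : θ ≤ 1) (r : ℕ) :
    (lineTest μ θ r).expCalls μ O ≤ ENNReal.ofReal (1605 * (√(Fintype.card S) / θ)) := by
  have h1 := one_le_sqrt_card_div (β := S) hθ hθ1
  refine tsum_mul_le_of_forall_le _ fun i => ?_
  refine (add_le_add_right (tsum_mul_le_of_forall_le _ fun x => (isSampler_coordSampler hO
    (lineMass_pos_of_support hμ x i)).expCalls_stagedTest_null hθ hθ1 r 0) 1).trans ?_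
  rw [← ENNReal.ofReal_one, ← ENNReal.ofReal_add zero_le_one (by positivity)]
  exact ENNReal.ofReal_le_ofReal (by linarith)

open Classical in
/-- The probability that the line through a sample in a random direction has divergence at
least `τ`. -/
noncomputable def farLineProb (π μ : PMF (Fin n → S)) (τ : ℝ) : ℝ :=
  ∑ i : Fin n, (n : ℝ)⁻¹ * ∑ x, (π x).toReal * if τ ≤ lineKL π μ x i then 1 else 0

theorem farLineProb_le_rejectProb_lineTest [NeZero n] [Nonempty S] (hμ : ∀ x, μ x ≠ 0) {η τ : ℝ}
    (hη : 0 < η) (hη2 : η ≤ 1 / 2) (hb : IsBalanced η μ) (hτ : 0 < τ)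
    (hO : IsCoordinateOracle π O) (r : ℕ) :
    2 / 3 * farLineProb π μ τ ≤
      rejectProb (lineTest μ (τ / (12 * Real.log (1 / η))) r) π O := by
  classical
  have hL := half_le_log_inv hη hη2
  rw [rejectProb_lineTest, farLineProb, Finset.mul_sum]
  refine Finset.sum_le_sum fun i _ => ?_
  rw [mul_left_comm, Finset.mul_sum]
  refine mul_le_mul_of_nonneg_left (Finset.sum_le_sum fun x _ => ?_) (by positivity)
  rw [mul_left_comm]
  -- A sample of `π` almost surely lies on lines of positive mass, so arbitrary oracle answers never
  -- matter.
  rcases (ENNReal.toReal_nonneg (a := π x)).eq_or_lt with h0 | h0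
  · simp [← h0]
  refine mul_le_mul_of_nonneg_left ?_ h0.le
  split_ifs with h
  · have hmass := h0.trans_le (le_lineMass π x i)
    have hs := isSampler_coordSampler hO hmass
    have hD := half_le_sum_testWeight hs.nonneg hs.sum_eq_one
      (sum_condLine_update μ (lineMass_pos_of_support hμ x i)) hη hη2 (hb x i) hτ h
    have := hs.one_sub_rejectProb_stagedTest_le (fun b => condLine_nonneg _ _ _ _)
      (by positivity) hD r 0
    linarith
  · rw [mul_zero]; exact rejectProb_nonneg _ _ _

theorem min_le_add_sum_levels (c z : ℝ) (J : ℕ) :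
    min z (2 ^ J * c) ≤ c + ∑ j ∈ Finset.range J, 2 ^ j * c * if 2 ^ j * c ≤ z then 1 else 0 := by
  induction J with
  | zero => simp
  | succ J ih =>
    rw [Finset.sum_range_succ, ← add_assoc]
    split_ifs with h
    · rw [min_eq_right h] at ih
      refine (min_le_right _ _).trans ?_
      rw [pow_succ]; linarith
    · rw [min_eq_left (not_le.1 h).le] at ih
      refine (min_le_left _ _).trans ?_
      linarith

/-- Average the dyadic bound `min_le_add_sum_levels`: divergences below `δ / 2` account for at most
half of the mean `δ`, and the cap `L` makes `J` levels enough. -/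
theorem one_le_sum_farLineProb [NeZero n] {δ L : ℝ} (hδ : 0 < δ) {J : ℕ}
    (hJ : L ≤ 2 ^ J * (δ / 2)) (hL : ∀ x i, 0 < (π x).toReal → lineKL π μ x i ≤ L)
    (h : n * δ ≤ ∑ i, ∑ x, (π x).toReal * lineKL π μ x i) :
    1 ≤ ∑ j ∈ Finset.range J, 2 ^ j * farLineProb π μ (2 ^ j * (δ / 2)) := by
  classical
  have hn : (0 : ℝ) < n := by exact_mod_cast Nat.pos_of_ne_zero (NeZero.ne n)
  have hle : ∀ (i : Fin n) x, (π x).toReal * lineKL π μ x i ≤ (π x).toReal * (δ / 2 +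
      ∑ j ∈ Finset.range J, 2 ^ j * (δ / 2) *
        if 2 ^ j * (δ / 2) ≤ lineKL π μ x i then 1 else 0) := by
    intro i x
    rcases (ENNReal.toReal_nonneg (a := π x)).eq_or_lt with h0 | h0
    · simp [← h0]
    · have h1 := min_le_add_sum_levels (δ / 2) (lineKL π μ x i) J
      rw [min_eq_left ((hL x i h0).trans hJ)] at h1
      exact mul_le_mul_of_nonneg_left h1 h0.le
  have h2 := h.trans (Finset.sum_le_sum fun i _ => Finset.sum_le_sum fun x _ => hle i x)
  have h3 : ∑ i : Fin n, ∑ x, (π x).toReal * (δ / 2 +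
      ∑ j ∈ Finset.range J, 2 ^ j * (δ / 2) *
        if 2 ^ j * (δ / 2) ≤ lineKL π μ x i then 1 else 0) =
      n * (δ / 2) +
        n * (δ / 2) * ∑ j ∈ Finset.range J, 2 ^ j * farLineProb π μ (2 ^ j * (δ / 2)) := by
    simp only [mul_add, Finset.sum_add_distrib, ← Finset.sum_mul, sum_toReal_eq_one, one_mul]
    congr 1
    · simp
    · simp only [farLineProb, Finset.mul_sum]
      rw [Finset.sum_comm (s := Finset.range J)]
      refine Finset.sum_congr rfl fun i _ => ?_
      rw [Finset.sum_comm (s := Finset.range J)]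
      refine Finset.sum_congr rfl fun x _ => Finset.sum_congr rfl fun j _ => ?_
      field_simp
  rw [h3] at h2
  have h4 : 0 < n * (δ / 2) := by positivity
  by_contra hlt
  push Not at hlt
  nlinarith

end Lines

theorem add_le_one_of_ne {β : Type*} [Fintype β] {q : β → ℝ} (hq : ∀ b, 0 ≤ q b)
    (hq1 : ∑ b, q b = 1) {a b : β} (hab : a ≠ b) : q a + q b ≤ 1 := by
  classical
  rw [← hq1, ← Finset.sum_pair hab]
  exact Finset.sum_le_sum_of_subset_of_nonneg (Finset.subset_univ _) fun c _ _ => hq c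

/-! ### Consequences of balancedness and the combined test on lines. -/

section Balanced

variable {n : ℕ} {S : Type u} [Fintype S] {μ : PMF (Fin n → S)} {η : ℝ}

theorem IsBalanced.ne_zero [NeZero n] (hb : IsBalanced η μ) (hη : 0 < η) (x : Fin n → S) :
    μ x ≠ 0 := by
  intro h
  have h1 := hb x 0 (x 0)
  rw [condLine_update, Function.update_eq_self, h] at h1
  simp at h1
  linarith

theorem IsBalanced.le_half [NeZero n] [Nontrivial S] (hb : IsBalanced η μ) (hη : 0 < η) :
    η ≤ 1 / 2 := by
  obtain ⟨a, b, hab⟩ := exists_pair_ne S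
  have h := add_le_one_of_ne (fun _ => condLine_nonneg μ (fun _ => a) 0 _)
    (sum_condLine_update μ (lineMass_pos_of_support (hb.ne_zero hη) (fun _ => a) 0)) hab
  have h1 := hb (fun _ => a) 0 a
  have h2 := hb (fun _ => a) 0 b
  linarith

theorem IsBalanced.lineKL_le (hb : IsBalanced η μ) (hη : 0 < η) {π : PMF (Fin n → S)}
    (x : Fin n → S) (i : Fin n) (hx : 0 < (π x).toReal) : lineKL π μ x i ≤ Real.log (1 / η) :=
  klSum_le_log_inv (fun _ => condLine_nonneg _ _ _ _)
    (sum_condLine_update π (hx.trans_le (le_lineMass π x i))) hη (hb x i)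

theorem IsBalanced.sum_lineKL_le (hb : IsBalanced η μ) (hη : 0 < η) (π : PMF (Fin n → S)) :
    ∑ i : Fin n, ∑ x, (π x).toReal * lineKL π μ x i ≤ n * Real.log (1 / η) := by
  calc _ ≤ ∑ i : Fin n, ∑ x, (π x).toReal * Real.log (1 / η) := by
        refine Finset.sum_le_sum fun i _ => Finset.sum_le_sum fun x _ => ?_
        rcases (ENNReal.toReal_nonneg (a := π x)).eq_or_lt with h0 | h0
        · simp [← h0]
        · exact mul_le_mul_of_nonneg_left (hb.lineKL_le hη x i h0) h0.le
    _ = n * Real.log (1 / η) := by simp [← Finset.sum_mul, sum_toReal_eq_one]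

end Balanced

/-- `J` is bounded by a sum of logarithms, and a product dominates this sum because each factor is
at least `log 2`. -/
theorem levels_le {M L : ℝ} {J : ℕ} (hM : 0 < M) (hL : 1 / 2 ≤ L)
    (hJ : (2 : ℝ) ^ J ≤ 8 * M * L) :
    (J : ℝ) ≤ 20 * (Real.log (2 + M) ^ 2 * Real.log (2 + L)) := by
  have h2 := Real.log_two_gt_d9
  have h3 := Real.log_two_lt_d9
  have ha : Real.log 2 ≤ Real.log (2 + M) := Real.log_le_log two_pos (by linarith)
  have hb : Real.log 2 ≤ Real.log (2 + L) := Real.log_le_log two_pos (by linarith)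
  have h4 : J * Real.log 2 ≤ 3 * Real.log 2 + Real.log (2 + M) + Real.log (2 + L) := by
    calc J * Real.log 2 = Real.log (2 ^ J) := by rw [Real.log_pow]
      _ ≤ Real.log (2 ^ 3 * (2 + M) * (2 + L)) := by
          refine Real.log_le_log (by positivity) (hJ.trans ?_)
          nlinarith [mul_pos hM (by linarith : 0 < L)]
      _ = _ := by
          rw [Real.log_mul (by positivity) (by positivity),
            Real.log_mul (by norm_num) (by positivity), Real.log_pow]
          norm_num
  set a := Real.log (2 + M)
  set b := Real.log (2 + L)
  have hJ0 : (0 : ℝ) ≤ J := Nat.cast_nonneg J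
  have ha' : 0.69 ≤ a := by linarith
  have hb' : 0.69 ≤ b := by linarith
  have h5 : 0.69 * J ≤ 2.1 + a + b := by nlinarith
  have h6 : 0.69 * a ≤ a ^ 2 := by nlinarith
  have h7 : 0.4761 ≤ a ^ 2 := by nlinarith
  have h8 : 0.4761 * b ≤ a ^ 2 * b := by nlinarith
  have h9 : 0.4761 * a ≤ a ^ 2 * b := by nlinarith
  have h10 : 0.328 ≤ a ^ 2 * b := by nlinarith
  nlinarith

theorem exists_linesTest {n : ℕ} [NeZero n] {S : Type u} [Fintype S] [Nonempty S]
    {μ : PMF (Fin n → S)} {c η ε : ℝ} (hc : 0 < c) (hε : 0 < ε) (hη : 0 < η) (hη2 : η ≤ 1 / 2)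
    (hb : IsBalanced η μ) :
    ∃ A : OracleAlg n S Verdict,
      (∀ O, IsCoordinateOracle μ O → rejectProb A μ O ≤ 0.05 ∧
        A.expCalls μ O ≤ ENNReal.ofReal (4622400 * (c * n / ε * Real.log (2 + c * n / ε) ^ 2 *
          √(Fintype.card S) * Real.log (1 / η) * Real.log (2 + Real.log (1 / η))))) ∧
      ∀ (π : PMF (Fin n → S)) (O), IsCoordinateOracle π O →
        ε / 2 ≤ c * ∑ i, ∑ x, (π x).toReal * lineKL π μ x i → 0.6 ≤ rejectProb A π O := by
  have hμ := hb.ne_zero hη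
  have hn : (0 : ℝ) < n := by exact_mod_cast Nat.pos_of_ne_zero (NeZero.ne n)
  have hL := half_le_log_inv hη hη2
  have hlineL := fun π => hb.lineKL_le hη (π := π)
  have hsumL := hb.sum_lineKL_le hη
  set L := Real.log (1 / η) with hLdef
  set M := c * n / ε with hM
  have hMpos : 0 < M := by positivity
  set s := √(Fintype.card S : ℝ) with hs
  by_cases hML : 1 / 2 ≤ M * L
  swap
  -- Here even the maximal divergence `L` on every line is too small for the alternative to occur.
  · refine ⟨done Verdict.accept, fun O _ => ⟨?_, by simp [expCalls]⟩, fun π O _ h => ?_⟩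
    · rw [rejectProb_accept]; norm_num
    · exfalso
      apply hML
      rw [hM, div_mul_eq_mul_div, le_div_iff₀ hε]
      nlinarith [mul_le_mul_of_nonneg_left (hsumL π) hc.le]
  -- The top level `J'` satisfies `τ J' ≤ L < τ (J' + 1)`: all divergences are covered and every `θ
  -- j` stays below `1`.
  obtain ⟨J', hJ1, hJ2⟩ := exists_nat_pow_near (x := 4 * M * L) (y := 2) (by linarith) one_lt_two
  set J := J' + 1 with hJdef
  set δ := 1 / (2 * M) with hδdef
  have hδ : 0 < δ := by positivity
  set τ : ℕ → ℝ := fun j => 2 ^ j * (δ / 2) with hτdef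
  have hτ : ∀ j, 0 < τ j := fun j => by positivity
  set θ : ℕ → ℝ := fun j => τ j / (12 * L) with hθdef
  have hθ : ∀ j, 0 < θ j := fun j => div_pos (hτ j) (by linarith)
  have hθ1 : ∀ j < J, θ j ≤ 1 := by
    intro j hj
    rw [hθdef]
    dsimp only
    rw [div_le_one (by linarith)]
    have h1 : (2 : ℝ) ^ j ≤ 4 * M * L :=
      (pow_le_pow_right₀ one_le_two (Nat.lt_succ_iff.1 hj)).trans hJ1
    calc τ j ≤ 4 * M * L * (δ / 2) := by
          exact mul_le_mul_of_nonneg_right h1 (by positivity)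
      _ = L := by rw [hδdef]; field_simp; norm_num
      _ ≤ 12 * L := by linarith
  -- The union bound over all line tests only enlarges `r`, on which the expected cost bound does
  -- not depend.
  obtain ⟨r, hr⟩ : ∃ r : ℕ, (1 / 8 : ℝ) ^ r <
      0.05 / (1 + ∑ j ∈ Finset.range J, ((3 * 2 ^ j : ℕ) : ℝ)) :=
    exists_pow_lt_of_lt_one (by positivity) (by norm_num)
  -- With `3 * 2 ^ j` runs, each detecting with probability at least `2 / 3 * farLineProb`, the
  -- acceptance exponent is at least `2`, and `exp (-2) ≤ 1 / 3`.
  refine ⟨sequenceTest (fun j => sequenceTest (fun _ => lineTest μ (θ j) r) (3 * 2 ^ j)) J,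
    fun O hO => ⟨?_, ?_⟩, fun π O hO h => ?_⟩
  · calc _ ≤ ∑ j ∈ Finset.range J, ((3 * 2 ^ j : ℕ) : ℝ) * (1 / 8) ^ r := by
          refine (rejectProb_sequenceTest_le _ _ _ _).trans (Finset.sum_le_sum fun j _ => ?_)
          refine (rejectProb_sequenceTest_le _ _ _ _).trans ?_
          refine (Finset.sum_le_sum fun _ _ =>
            rejectProb_lineTest_null hμ hO (hθ j) r).trans_eq ?_
          simp
      _ ≤ 0.05 := by
          rw [← Finset.sum_mul]
          rw [lt_div_iff₀ (by positivity)] at hr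
          have : (0 : ℝ) < (1 / 8) ^ r := by positivity
          linarith
  · have hlevel : ∀ j ∈ Finset.range J,
        (sequenceTest (fun _ => lineTest μ (θ j) r) (3 * 2 ^ j)).expCalls μ O ≤
          ENNReal.ofReal (231120 * (M * L * s)) := by
      intro j hj
      refine (expCalls_sequenceTest_le _ _ _ _).trans ?_
      refine (Finset.sum_le_sum fun _ _ => expCalls_lineTest_null hμ hO (hθ j)
        (hθ1 j (Finset.mem_range.1 hj)) r).trans_eq ?_
      rw [Finset.sum_const, Finset.card_range, nsmul_eq_mul, ← ENNReal.ofReal_natCast,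
        ← ENNReal.ofReal_mul (by positivity)]
      congr 1
      rw [hθdef]
      simp only [hτdef, hδdef]
      push_cast
      rw [hs]
      field_simp
      ring
    refine (expCalls_sequenceTest_le _ _ _ _).trans ((Finset.sum_le_sum hlevel).trans ?_)
    rw [Finset.sum_const, Finset.card_range, nsmul_eq_mul, ← ENNReal.ofReal_natCast,
      ← ENNReal.ofReal_mul (by positivity)]
    refine ENNReal.ofReal_le_ofReal ?_
    have hlev : (J : ℝ) ≤ _ := levels_le hMpos hL (by rw [hJdef, pow_succ]; linarith)
    have h2 : 0 ≤ 231120 * (M * L * s) := by positivity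
    exact (mul_le_mul_of_nonneg_right hlev h2).trans_eq (by ring)
  · have h1 : n * δ ≤ ∑ i : Fin n, ∑ x, (π x).toReal * lineKL π μ x i := by
      have : n * δ = ε / 2 / c := by rw [hδdef, hM]; field_simp
      rw [this, div_le_iff₀ hc, mul_comm]
      exact h
    have hJL : L ≤ 2 ^ J * (δ / 2) := by
      have : L = 4 * M * L * (δ / 2) := by rw [hδdef]; field_simp; norm_num
      rw [this]
      gcongr
    have h2 := one_le_sum_farLineProb hδ hJL (fun x i => hlineL π x i) h1
    have h3 := one_sub_rejectProb_sequenceTest_le π O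
      (fun j => sequenceTest (fun _ => lineTest μ (θ j) r) (3 * 2 ^ j)) J
      (r := fun j => 2 * (2 ^ j * farLineProb π μ (τ j))) fun j _ => by
        refine (one_sub_rejectProb_sequenceTest_le π O (fun _ => lineTest μ (θ j) r) (3 * 2 ^ j)
          (r := fun _ => 2 / 3 * farLineProb π μ (τ j)) fun _ _ => ?_).trans_eq ?_
        · have h4 := farLineProb_le_rejectProb_lineTest hμ hη hη2 hb (hτ j) hO r
          refine le_trans ?_ (Real.one_sub_le_exp_neg _)
          linarith
        · congr 1
          rw [Finset.sum_const, Finset.card_range, nsmul_eq_mul]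
          push_cast
          ring
    rw [← Finset.mul_sum] at h3
    have h5 : Real.exp (-(2 * ∑ j ∈ Finset.range J, 2 ^ j * farLineProb π μ (τ j))) ≤ 1 / 3 := by
      have h6 : 3 ≤ Real.exp 2 := by linarith [Real.add_one_le_exp 2]
      calc _ ≤ Real.exp (-2) := Real.exp_le_exp.2 (by linarith)
        _ ≤ 1 / 3 := by
          rw [Real.exp_neg, one_div]
          exact inv_anti₀ (by norm_num) h6
    linarith

/-! ### The test on posterior labels. -/

/-- The law of the component of a mixture given the sample. -/
noncomputable def posterior {k n : ℕ} {S : Type u} (ρ : PMF (Fin k))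
    (μs : Fin k → PMF (Fin n → S)) (h : ∀ x, ρ.bind μs x ≠ 0) (x : Fin n → S) : PMF (Fin k) :=
  PMF.normalize (fun a => ρ a * μs a x) (by rw [← PMF.bind_apply]; exact h x)
    (by rw [← PMF.bind_apply]; exact PMF.apply_ne_top _ _)

theorem posterior_toReal {k n : ℕ} {S : Type u} (ρ : PMF (Fin k))
    (μs : Fin k → PMF (Fin n → S)) (h : ∀ x, ρ.bind μs x ≠ 0) (x : Fin n → S) (a : Fin k) :
    (posterior ρ μs h x a).toReal =
      (ρ a).toReal * (μs a x).toReal / (ρ.bind μs x).toReal := by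
  rw [posterior, PMF.normalize_apply, ← PMF.bind_apply, ENNReal.toReal_mul, ENNReal.toReal_mul,
    ENNReal.toReal_inv, div_eq_mul_inv]

theorem klSum_posterior_le {k n : ℕ} {S : Type u} [Fintype S] {ρ : PMF (Fin k)}
    {μs : Fin k → PMF (Fin n → S)} (hρ : ∀ a, 0 < ρ a) (hμ : ∀ x, ρ.bind μs x ≠ 0)
    (π : PMF (Fin n → S)) :
    klSum (fun a => ∑ x, (π x).toReal *
        ((ρ a).toReal * (μs a x).toReal / (ρ.bind μs x).toReal)) (fun a => (ρ a).toReal) ≤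
      Real.log (1 / ⨅ a, (ρ a).toReal) := by
  have hk : Nonempty (Fin k) := ρ.support_nonempty.to_type
  obtain ⟨a₀, ha₀⟩ := exists_eq_ciInf_of_finite (f := fun a => (ρ a).toReal)
  have hs := isSampler_labelSampler (π := π) (O := fun _ _ => π) (posterior ρ μs hμ)
  simp only [posterior_toReal] at hs
  refine klSum_le_log_inv hs.nonneg hs.sum_eq_one ?_ fun a =>
    ciInf_le (Set.finite_range _).bddBelow a
  rw [← ha₀]
  exact ENNReal.toReal_pos (hρ a₀).ne' (PMF.apply_ne_top _ _)

/-- Posterior labels have law `ρ` under the null, so this is an identity test on `Fin k`. A single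
stage of accuracy `400` suffices, since no union bound is involved. -/
theorem exists_mixtureTest {k n : ℕ} {S : Type u} [Fintype S] {ρ : PMF (Fin k)}
    {μs : Fin k → PMF (Fin n → S)} {ε : ℝ} (hε : 0 < ε) (hρ : ∀ a, 0 < ρ a)
    (hμ : ∀ x, ρ.bind μs x ≠ 0) :
    ∃ A : OracleAlg n S Verdict,
      (∀ O, rejectProb A (ρ.bind μs) O ≤ 0.05 ∧ A.expCalls (ρ.bind μs) O ≤
        ENNReal.ofReal (19248 * (√k * Real.log (1 / ⨅ a, (ρ a).toReal) / ε))) ∧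
      ∀ (π : PMF (Fin n → S)) (O),
        ε / 2 ≤ klSum (fun a => ∑ x, (π x).toReal *
          ((ρ a).toReal * (μs a x).toReal / (ρ.bind μs x).toReal)) (fun a => (ρ a).toReal) →
        0.6 ≤ rejectProb A π O := by
  have hk : Nonempty (Fin k) := ρ.support_nonempty.to_type
  have hρ' : ∀ a, 0 < (ρ a).toReal := fun a => ENNReal.toReal_pos (hρ a).ne' (PMF.apply_ne_top _ _)
  obtain ⟨a₀, ha₀⟩ := exists_eq_ciInf_of_finite (f := fun a => (ρ a).toReal)
  have hle : ∀ a, ⨅ a, (ρ a).toReal ≤ (ρ a).toReal := fun a =>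
    ciInf_le (Set.finite_range _).bddBelow a
  set η := ⨅ a, (ρ a).toReal with hηdef
  have hη : 0 < η := ha₀ ▸ hρ' a₀
  set L := Real.log (1 / η) with hL
  have hsmp := fun (π : PMF (Fin n → S)) O =>
    isSampler_labelSampler (π := π) (O := O) (posterior ρ μs hμ)
  simp only [posterior_toReal] at hsmp
  by_cases hact : ε / 2 ≤ L
  swap
  · refine ⟨done Verdict.accept, fun O => ⟨?_, by simp [expCalls]⟩, fun π O h => ?_⟩
    · rw [rejectProb_accept]; norm_num
    · exact absurd (h.trans (klSum_posterior_le hρ hμ π)) hact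
  -- With a single component `L = 0`, contrary to `hact`; two components share mass at most `1`.
  have hη2 : η ≤ 1 / 2 := by
    have h1 : ∃ b, b ≠ a₀ := by
      by_contra! hall
      have h2 := sum_toReal_eq_one ρ
      rw [Fintype.sum_eq_single a₀ fun b hb => absurd (hall b) hb] at h2
      rw [hL, ← ha₀, h2] at hact
      simp at hact
      linarith
    obtain ⟨b, hb⟩ := h1
    have := add_le_one_of_ne (fun a => (hρ' a).le) (sum_toReal_eq_one ρ) hb
    linarith [hle b, hle a₀]
  have hLpos := half_le_log_inv hη hη2
  rw [← hL] at hLpos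
  set θ := ε / 2 / (12 * L) with hθdef
  have hθ : 0 < θ := by positivity
  have hθ1 : θ ≤ 1 := by rw [hθdef, div_le_one (by linarith)]; linarith
  refine ⟨identityTest (fun a => (ρ a).toReal) θ (batchSize (Fin k) 400 θ)
    (labelSampler (posterior ρ μs hμ)), fun O => ?_, fun π O h => ?_⟩
  · have hnull := hsmp (ρ.bind μs) O
    have heq : (fun a => ∑ x, (ρ.bind μs x).toReal *
        ((ρ a).toReal * (μs a x).toReal / (ρ.bind μs x).toReal)) = fun a => (ρ a).toReal := by
      ext a
      have : ∀ x, (ρ.bind μs x).toReal *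
          ((ρ a).toReal * (μs a x).toReal / (ρ.bind μs x).toReal) =
            (ρ a).toReal * (μs a x).toReal := fun x =>
        mul_div_cancel₀ _ (toReal_pos_of_support hμ x).ne'
      simp only [this, ← Finset.mul_sum, sum_toReal_eq_one, mul_one]
    rw [heq] at hnull
    constructor
    · refine (hnull.rejectProb_identityTest_null hθ (batchSize_pos (by norm_num) hθ)
        (by norm_num : (0 : ℝ) < 400) (le_batchSize_mul hθ)).trans (by norm_num)
    · refine hnull.expCalls_identityTest_le.trans ?_
      have h2 := two_mul_batchSize_le (β := Fin k) le_rfl hθ hθ1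
      have h3 : (2 * (batchSize (Fin k) 400 θ : ℝ≥0∞)) =
          ENNReal.ofReal (2 * (batchSize (Fin k) 400 θ : ℝ)) := by
        rw [ENNReal.ofReal_mul (by norm_num)]; simp
      rw [h3]
      refine ENNReal.ofReal_le_ofReal (h2.trans (le_of_eq ?_))
      rw [hθdef, Fintype.card_fin]
      field_simp
      ring
  · have hs := hsmp π O
    have hD := half_le_sum_testWeight hs.nonneg hs.sum_eq_one (sum_toReal_eq_one ρ) hη hη2 hle
      (by positivity) h
    have := hs.one_sub_rejectProb_identityTest_le (fun a => (hρ' a).le) hθ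
      (batchSize_pos (by norm_num) hθ) (by norm_num : (1 : ℝ) ≤ 400) (le_batchSize_mul hθ) hD
    linarith

theorem eq_of_subsingleton {Ω : Type*} [Subsingleton Ω] (π μ : PMF Ω) : π = μ := by
  have h : ∀ (ν : PMF Ω) x, ν x = 1 := fun ν x =>
    (PMF.apply_eq_one_iff ν x).2 ((Set.subsingleton_of_subsingleton.eq_empty_or_singleton.resolve_left
      ν.support_nonempty.ne_empty).elim fun y hy => by rw [hy, Subsingleton.elim y x])
  exact PMF.ext fun x => (h π x).trans (h μ x).symm

theorem klDiv_self_eq_zero {Ω : Type*} (μ : PMF Ω) : IdentityTesting.klDiv μ μ = 0 := by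
  let _ : MeasurableSpace Ω := ⊤
  exact InformationTheory.klDiv_self μ.toMeasure

theorem IsBalanced.log_inv_nonneg {n : ℕ} {S : Type u} [Fintype S] {μ : PMF (Fin n → S)} {η : ℝ}
    [NeZero n] (hb : IsBalanced η μ) (hη : 0 < η) : 0 ≤ Real.log (1 / η) := by
  obtain ⟨x, -⟩ := μ.support_nonempty
  have h := hb x 0 (x 0)
  rw [condLine_update, Function.update_eq_self] at h
  have h1 := h.trans (div_le_one_of_le₀ (le_lineMass μ x 0) (lineMass_nonneg μ x 0))
  exact Real.log_nonneg (by rwa [le_div_iff₀ hη, one_mul])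

theorem log_inv_iInf_nonneg {k : ℕ} (ρ : PMF (Fin k)) (hρ : ∀ a, 0 < ρ a) :
    0 ≤ Real.log (1 / ⨅ a, (ρ a).toReal) := by
  have hk : Nonempty (Fin k) := ρ.support_nonempty.to_type
  obtain ⟨a, ha⟩ := exists_eq_ciInf_of_finite (f := fun a => (ρ a).toReal)
  rw [← ha]
  have h0 : 0 < (ρ a).toReal := ENNReal.toReal_pos (hρ a).ne' (PMF.apply_ne_top _ _)
  have h1 : (ρ a).toReal ≤ 1 :=
    ENNReal.toReal_le_of_le_ofReal zero_le_one (by simpa using PMF.coe_le_one _ _)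
  exact Real.log_nonneg (by rwa [le_div_iff₀ h0, one_mul])

/-- Serves to absorb the rounding of the call budget into the multiplicative constant. -/
theorem one_le_add_of_le {n k : ℕ} {c ε s L L' : ℝ} (hc : 0 < c) (hε : 0 < ε) (hs : 1 ≤ s)
    (hL : 0 ≤ L) (hL' : 0 ≤ L') (hk : 0 < k) (h : ε ≤ L' + c * (n * L)) :
    1 ≤ 4 * (c * n / ε * Real.log (2 + c * n / ε) ^ 2 * s * L * Real.log (2 + L)) +
      √k * L' / ε := by
  have hM : 0 ≤ c * n / ε := by positivity
  set M := c * n / ε with hMdef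
  have h2 := Real.log_two_gt_d9
  have ha : Real.log 2 ≤ Real.log (2 + M) := Real.log_le_log two_pos (by linarith)
  have hb : Real.log 2 ≤ Real.log (2 + L) := Real.log_le_log two_pos (by linarith)
  have h10 : 1 ≤ 4 * (Real.log (2 + M) ^ 2 * Real.log (2 + L)) := by
    set a := Real.log (2 + M)
    set b := Real.log (2 + L)
    have h7 : 0.4761 ≤ a ^ 2 := by nlinarith
    nlinarith
  have h3 : 1 ≤ M * L + L' / ε := by
    have : M * L + L' / ε = (L' + c * (n * L)) / ε := by rw [hMdef]; field_simp; ring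
    rw [this, le_div_iff₀ hε, one_mul]; exact h
  have h4 : L' / ε ≤ √k * L' / ε := by
    have : 1 ≤ √(k : ℝ) := Real.one_le_sqrt.2 (by exact_mod_cast hk)
    gcongr
    nlinarith
  have h5 : M * L ≤ 4 * (M * Real.log (2 + M) ^ 2 * s * L * Real.log (2 + L)) := by
    calc M * L = M * L * 1 * 1 := by ring
      _ ≤ M * L * s * (4 * (Real.log (2 + M) ^ 2 * Real.log (2 + L))) := by gcongr
      _ = _ := by ring
  linarith

end IdentityTesting

/-! ### Assembly of the two tests under a worst-case budget. -/

open IdentityTesting in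
theorem theorem4p3 :
    ∃ C : ℝ, 0 < C ∧
      ∀ (S : Type u) [Fintype S] (n k : ℕ)
        (ρ : PMF (Fin k)) (μs : Fin k → PMF (Fin n → S)) (c η ε : ℝ),
        1 ≤ c → 0 < η → 0 < ε →
        (∀ a, 0 < ρ a) →
        (∀ a, IsATE c (μs a)) →
        IsBalanced η (ρ.bind μs) →
        ∃ A : OracleAlg n S Verdict,
          (∃ N : ℕ, A.calls ≤ N ∧
            (N : ℝ) ≤
              C * (c * n / ε * Real.log (2 + c * n / ε) ^ 2 * √(Fintype.card S : ℝ) *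
                Real.log (1 / η) * Real.log (2 + Real.log (1 / η))) +
              C * (√(k : ℝ) * Real.log (1 / ⨅ a, (ρ a).toReal) / ε)) ∧
          (∀ O, IsCoordinateOracle (ρ.bind μs) O →
            rejectProb A (ρ.bind μs) O ≤ 0.4) ∧
          (∀ (π : PMF (Fin n → S)) (O : (Fin n → S) → Fin n → PMF (Fin n → S)),
            IsCoordinateOracle π O →
            ENNReal.ofReal ε ≤ IdentityTesting.klDiv π (ρ.bind μs) →
            0.6 ≤ rejectProb A π O) := by
  -- The budget is `⌈20 * V⌉₊ ≤ 21 * V`, because `1 ≤ V`.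
  refine ⟨21 * 4622400, by norm_num, ?_⟩
  intro S _ n k ρ μs c η ε hc hη hε hρ hate hb
  have hc0 : 0 < c := by linarith
  have hL' := log_inv_iInf_nonneg ρ hρ
  set μ := ρ.bind μs with hμdef
  set V₂ := √(k : ℝ) * Real.log (1 / ⨅ a, (ρ a).toReal) / ε with hV₂
  have hV₂0 : 0 ≤ V₂ := by positivity
  set V₁ := c * n / ε * Real.log (2 + c * n / ε) ^ 2 * √(Fintype.card S : ℝ) *
    Real.log (1 / η) * Real.log (2 + Real.log (1 / η)) with hV₁
  have hV₁0 : 0 ≤ V₁ := by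
    rcases Nat.eq_zero_or_pos n with rfl | hn
    · simp [hV₁]
    · have : NeZero n := ⟨hn.ne'⟩
      have h1 := hb.log_inv_nonneg hη
      have h2 : 0 ≤ Real.log (2 + Real.log (1 / η)) := Real.log_nonneg (by linarith)
      positivity
  rcases subsingleton_or_nontrivial (Fin n → S) with hsub | hnt
  · refine ⟨OracleAlg.done Verdict.accept, ⟨0, by simp [OracleAlg.calls], ?_⟩, fun O _ => ?_,
      fun π O _ h => ?_⟩
    · push_cast; positivity
    · rw [rejectProb_accept]; norm_num
    · rw [eq_of_subsingleton π μ, klDiv_self_eq_zero, nonpos_iff_eq_zero,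
        ENNReal.ofReal_eq_zero] at h
      linarith
  have hn : NeZero n := ⟨by
    rintro rfl
    exact not_subsingleton (Fin 0 → S) inferInstance⟩
  have hS : Nontrivial S := by
    rw [← not_subsingleton_iff_nontrivial]
    intro h
    exact not_subsingleton (Fin n → S) inferInstance
  have hη2 := hb.le_half hη
  have hL := half_le_log_inv hη hη2
  have hμ := hb.ne_zero hη
  obtain ⟨A₁, hnull₁, halt₁⟩ := exists_linesTest hc0 hε hη hη2 hb
  obtain ⟨A₂, hnull₂, halt₂⟩ := exists_mixtureTest hε hρ hμ
  have hkl : ∀ π : PMF (Fin n → S), ENNReal.ofReal ε ≤ IdentityTesting.klDiv π μ →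
      ε ≤ klSum (fun a => ∑ x, (π x).toReal *
          ((ρ a).toReal * (μs a x).toReal / (μ x).toReal)) (fun a => (ρ a).toReal) +
        c * ∑ i, ∑ x, (π x).toReal * lineKL π μ x i := by
    intro π h
    have h1 := (ENNReal.ofReal_le_ofReal_iff' .. |>.1 (h.trans (klDiv_le_klSum π μ hμ)))
    have h2 : ε ≤ klSum (fun x => (π x).toReal) fun x => (μ x).toReal :=
      h1.resolve_right (by linarith)
    exact h2.trans (klSum_mixture_le hμ
      (fun a => ENNReal.toReal_pos (hρ a).ne' (PMF.apply_ne_top _ _))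
      (fun x => toReal_bind_apply ρ μs x) hc0.le hate π)
  -- The right side bounds every divergence from `μ`, so otherwise no alternative exists and
  -- accepting without calls is correct.
  by_cases hsmall : ε ≤ Real.log (1 / ⨅ a, (ρ a).toReal) + c * (n * Real.log (1 / η))
  swap
  · refine ⟨OracleAlg.done Verdict.accept, ⟨0, by simp [OracleAlg.calls], ?_⟩, fun O _ => ?_,
      fun π O _ h => absurd ((hkl π h).trans ?_) hsmall⟩
    · push_cast; positivity
    · rw [rejectProb_accept]; norm_num
    · exact add_le_add (klSum_posterior_le hρ hμ π)
        (mul_le_mul_of_nonneg_left (hb.sum_lineKL_le hη π) hc0.le)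
  set V := 4622400 * V₁ + 19248 * V₂ with hV
  have hcard : 1 ≤ √(Fintype.card S : ℝ) := Real.one_le_sqrt.2 (Nat.one_le_cast.2 Fintype.card_pos)
  have hk : 0 < k := Fin.pos_iff_nonempty.2 ρ.support_nonempty.to_type
  have hV1 : 1 ≤ V := by
    have := one_le_add_of_le hc0 hε hcard (by linarith) hL' hk hsmall
    linarith
  -- Markov's inequality makes an overrun cost at most `1 / 20` under the null, for a total error of
  -- at most `0.15`.
  set N := ⌈20 * V⌉₊ with hN
  have hNpos : 0 < N := Nat.ceil_pos.2 (by linarith)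
  refine ⟨(onAccept A₁ A₂).truncate N, ⟨N, OracleAlg.calls_truncate _ _, ?_⟩, fun O hO => ?_,
    fun π O hO h => ?_⟩
  · have := Nat.ceil_lt_add_one (a := 20 * V) (by linarith)
    linarith
  · obtain ⟨hr₁, he₁⟩ := hnull₁ O hO
    obtain ⟨hr₂, he₂⟩ := hnull₂ O
    have hE : (onAccept A₁ A₂).expCalls μ O ≤ ENNReal.ofReal V := by
      refine (expCalls_onAccept_le _ _ _ _).trans ((add_le_add he₁ he₂).trans ?_)
      rw [← ENNReal.ofReal_add (by positivity) (by positivity)]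
    have h1 := rejectProb_truncate_le μ O (onAccept A₁ A₂) hNpos (by linarith) hE
    have h2 := rejectProb_onAccept_le μ O A₁ A₂
    have h3 : V / N ≤ 1 / 20 := by
      rw [div_le_div_iff₀ (by exact_mod_cast hNpos) (by norm_num)]
      linarith [Nat.le_ceil (20 * V)]
    linarith
  · refine le_trans ?_ (rejectProb_le_truncate π O _ N)
    have h1 := rejectProb_onAccept π O A₁ A₂
    have h2 := rejectProb_le_one π O A₁
    have h3 := rejectProb_le_one π O A₂
    have h4 := rejectProb_nonneg π O A₁
    have h5 := rejectProb_nonneg π O A₂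
    rcases le_or_gt (ε / 2) (c * ∑ i, ∑ x, (π x).toReal * lineKL π μ x i) with h6 | h6
    · have := halt₁ π O hO h6
      nlinarith
    · have := halt₂ π O (by linarith [hkl π h])
      nlinarith
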